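/- Let $\mathcal A=\{\binom{k}{d} : k\ge 1,\ d\ge 0\}$ and let $\mathbb Q\langle\mathcal A\rangle$ be the $\mathbb Q$-vector space with basis the words in the letters of $\mathcal A$; write $\binom{k_1,\dots,k_r}{d_1,\dots,d_r}$ for the word $\binom{k_1}{d_1}\cdots\binom{k_r}{d_r}$. Equip it with the stuffle product, that is, the $\mathbb Q$-bilinear commutative product with $1\ast w=w\ast 1=w$ and $$\tbinom{k_1}{d_1}w\ast\tbinom{k_2}{d_2}v=\tbinom{k_1}{d_1}\bigl(w\ast\tbinom{k_2}{d_2}v\bigr)+\tbinom{k_2}{d_2}\bigl(\tbinom{k_1}{d_1}w\ast v\bigr)+\tbinom{k_1+k_2}{d_1+d_2}(w\ast v).$$ For $r\ge 0$ let $$\mathfrak A_r\tbinom{X_1,\dots,X_r}{Y_1,\dots,Y_r}=\sum_{k_i\ge1,\,d_i\ge0}\tbinom{k_1,\dots,k_r}{d_1,\dots,d_r}X_1^{k_1-1}\cdots X_r^{k_r-1}\frac{Y_1^{d_1}}{d_1!}\cdots\frac{Y_r^{d_r}}{d_r!},$$ and let $\sigma:\mathbb Q\langle\mathcal A\rangle\to\mathbb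 Q\langle\mathcal A\rangle$ (the swap) be the linear map sending the word $\binom{k_1,\dots,k_r}{d_1,\dots,d_r}$ to the coefficient of $X_1^{k_1-1}\cdots X_r^{k_r-1}\frac{Y_1^{d_1}}{d_1!}\cdots\frac{Y_r^{d_r}}{d_r!}$ in $$\mathfrak A_r\tbinom{Y_1+\dots+Y_r,\ \dots,\ Y_1+Y_2,\ Y_1}{X_r,\ X_{r-1}-X_r,\ \dots,\ X_1-X_2}.$$ The algebra of formal multiple Eisenstein series is $\mathcal G^f=(\mathbb Q\langle\mathcal A\rangle,\ast)/\mathcal I$, where $\mathcal I$ is the ideal generated by all $\sigma(w)-w$ with $w\in\mathbb Q\langle\mathcal A\rangle$. Write $G^f\binom{k_1,\dots,k_r}{d_1,\dots,d_r}$ for the class of a word, and $G^f(k_1,\dots,k_r)=G^f\binom{k_1,\dots,k_r}{0,\dots,0}$. Let $\mathfrak H^1=\mathbb Q\langle z_k : k\ge1\rangle$ with its stuffle product $\ast$ (defined by $z_iw\ast z_jv=z_i(w\ast z_jv)+z_j(z_iw\ast v)+z_{i+j}(w\ast v)$), let $\mathfrak H^0\subset\mathfrak H^1$ be the span of the words not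 starting with $z_1$, and let $ш$ be the shuffle product on $\mathfrak H^1$ obtained by viewing $\mathfrak H^1$ inside $\mathbb Q\langle x,y\rangle$ through $z_k=x^{k-1}y$. The algebra of formal multiple zeta values is $\mathcal Z^f=(\mathfrak H^1,\ast)/\mathfrak E$, where $\mathfrak E$ is the ideal generated by the extended double shuffle relations $w\ast v-w\,ш\,v$ with $w\in\mathfrak H^1$, $v\in\mathfrak H^0$; write $\zeta^f(k_1,\dots,k_r)$ for the class of $z_{k_1}\cdots z_{k_r}$. **Theorem.** There is a surjective homomorphism of $\mathbb Q$-algebras $\pi:\mathcal G^f\to\mathcal Z^f$ with $$\pi\bigl(G^f(k_1,\dots,k_r)\bigr)=\zeta^f(k_1,\dots,k_r)\qquad\text{for all } r\ge0,\ k_1,\dots,k_r\ge1,$$ whose kernel is the ideal $\mathfrak N$ of $\mathcal G^f$ generated by all $G^f\binom{k_1,\dots,k_n}{d_1,\dots,d_n}$ whose bi-index is not of the form $\binom{1,\dots,1,\,k_1,\dots,k_r}{d_1,\dots,d_s,\,0,\dots,0}$ for any $r,s\ge0$, $k_1,\dots,k_r\ge1$, $d_1,\dots,d_s\ge0$. 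-/

import Mathlib

namespace FormalMES

noncomputable section

/-! ### Quasi-shuffle (stuffle) algebras -/

/-- The rational vector space `ℚ⟨L⟩` with basis the words in the alphabet `L`.
For an alphabet with a commutative associative addition it is made into a commutative
algebra below, with the stuffle product (and not the concatenation product). -/
def WordAlg (L : Type) : Type := List L →₀ ℚ

namespace WordAlg

variable {L : Type}

instance : AddCommGroup (WordAlg L) := inferInstanceAs (AddCommGroup (List L →₀ ℚ))

instance : Module ℚ (WordAlg L) := inferInstanceAs (Module ℚ (List L →₀ ℚ))

/-- The basis element given by a word. -/
def word (w : List L) : WordAlg L := Finsupp.single w 1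

/-- The linear extension of a map on words. -/
def lift {M : Type} [AddCommGroup M] [Module ℚ M] (f : List L → M) : WordAlg L →ₗ[ℚ] M :=
  Finsupp.linearCombination ℚ f

@[simp] theorem lift_word {M : Type} [AddCommGroup M] [Module ℚ M] (f : List L → M)
    (w : List L) : lift f (word w) = f w := by
  simp only [lift, word]
  exact (Finsupp.linearCombination_single ℚ (1 : ℚ) w).trans (one_smul ℚ _)

theorem hom_ext {M : Type} [AddCommGroup M] [Module ℚ M] {f g : WordAlg L →ₗ[ℚ] M}
    (h : ∀ w, f (word w) = g (word w)) : f = g :=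
  Finsupp.lhom_ext' fun w => LinearMap.ext_ring (h w)

/-- Prepending the letter `a` to every word. -/
def cons (a : L) : WordAlg L →ₗ[ℚ] WordAlg L := lift fun w => word (a :: w)

@[simp] theorem cons_word (a : L) (w : List L) : cons a (word w) = word (a :: w) := by
  simp [cons]

section stuffle

variable [AddCommSemigroup L]

/-- The stuffle product of two words:
`a w ∗ b v = a (w ∗ b v) + b (a w ∗ v) + (a + b) (w ∗ v)`. -/
def stuffleWord : List L → List L → WordAlg L
  | [], v => word v
  | a :: w, [] => word (a :: w)
  | a :: w, b :: v =>
      cons a (stuffleWord w (b :: v)) + cons b (stuffleWord (a :: w) v)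
        + cons (a + b) (stuffleWord w v)
  termination_by w v => w.length + v.length

/-- The bilinear extension of the stuffle product of words. -/
def stuffle : WordAlg L →ₗ[ℚ] WordAlg L →ₗ[ℚ] WordAlg L :=
  lift fun w => lift fun v => stuffleWord w v

theorem stuffle_word (w v : List L) : stuffle (word w) (word v) = stuffleWord w v := by
  simp [stuffle]

theorem nil_stuffle (f : WordAlg L) : stuffle (word []) f = f := by
  have : stuffle (word ([] : List L)) = LinearMap.id := by
    apply hom_ext
    intro w
    simp [stuffle_word, stuffleWord]
  simp [this]

theorem stuffle_comm (f g : WordAlg L) : stuffle f g = stuffle g f := by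
  have key : ∀ n : ℕ, ∀ w v : List L, w.length + v.length = n →
      stuffleWord w v = stuffleWord v w := by
    intro n
    induction n using Nat.strong_induction_on with
    | _ n ih =>
      intro w v hn
      match w, v with
      | [], [] => rfl
      | [], b :: v => simp [stuffleWord]
      | a :: w, [] => simp [stuffleWord]
      | a :: w, b :: v =>
        simp only [List.length_cons] at hn
        rw [stuffleWord, stuffleWord, ih _ (by simp; omega) w (b :: v) rfl,
          ih _ (by simp; omega) (a :: w) v rfl, ih _ (by omega) w v rfl, add_comm b a]
        abel
  have h : (stuffle : WordAlg L →ₗ[ℚ] _) = stuffle.flip := by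
    refine hom_ext fun w => hom_ext fun v => ?_
    simp only [LinearMap.flip_apply, stuffle_word]
    exact key _ w v rfl
  exact congrArg (fun F => F f g) h

theorem stuffle_nil (f : WordAlg L) : stuffle f (word []) = f := by
  rw [stuffle_comm, nil_stuffle]

theorem stuffle_cons_cons (a b : L) (f g : WordAlg L) :
    stuffle (cons a f) (cons b g) =
      cons a (stuffle f (cons b g)) + cons b (stuffle (cons a f) g)
        + cons (a + b) (stuffle f g) := by
  have h : (stuffle.compl₁₂ (cons a) (cons b) : WordAlg L →ₗ[ℚ] WordAlg L →ₗ[ℚ] WordAlg L) =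
      (stuffle.compl₁₂ LinearMap.id (cons b)).compr₂ (cons a)
        + (stuffle.compl₁₂ (cons a) LinearMap.id).compr₂ (cons b)
        + stuffle.compr₂ (cons (a + b)) := by
    refine hom_ext fun w => hom_ext fun v => ?_
    simp [stuffle_word, stuffleWord]
  exact congrArg (fun F => F f g) h

theorem stuffle_assoc (f g h : WordAlg L) :
    stuffle (stuffle f g) h = stuffle f (stuffle g h) := by
  have key : ∀ n : ℕ, ∀ w v u : List L, w.length + v.length + u.length = n →
      stuffle (stuffle (word w) (word v)) (word u) =
        stuffle (word w) (stuffle (word v) (word u)) := by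
    intro n
    induction n using Nat.strong_induction_on with
    | _ n ih =>
      intro w v u hn
      match w, v, u with
      | [], v, u => simp only [nil_stuffle]
      | a :: w, [], u => simp only [nil_stuffle, stuffle_nil]
      | a :: w, b :: v, [] => simp only [stuffle_nil]
      | a :: w, b :: v, c :: u =>
        simp only [List.length_cons] at hn
        have h1 := ih _ (by simp; omega) w (b :: v) (c :: u) rfl
        have h2 := ih _ (by simp; omega) (a :: w) v (c :: u) rfl
        have h3 := ih _ (by simp; omega) (a :: w) (b :: v) u rfl
        have h4 := ih _ (by simp; omega) w v (c :: u) rfl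
        have h5 := ih _ (by simp; omega) w (b :: v) u rfl
        have h6 := ih _ (by simp; omega) (a :: w) v u rfl
        have h7 := ih _ (by omega) w v u rfl
        simp only [← cons_word, stuffle_cons_cons, map_add, LinearMap.add_apply, add_assoc]
          at h1 h2 h3 h4 h5 h6 h7 ⊢
        have e1 := congrArg (cons a) h1
        have e2 := congrArg (cons b) h2
        have e3 := congrArg (cons c) h3
        have e4 := congrArg (cons (a + b)) h4
        have e5 := congrArg (cons (a + c)) h5
        have e6 := congrArg (cons (b + c)) h6
        have e7 := congrArg (cons (a + (b + c))) h7
        simp only [map_add] at e1 e2 e3 e4 e5 e6 e7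
        rw [← sub_eq_zero] at e1 e2 e3 e4 e5 e6 e7 ⊢
        have e := congrArg₂ (· + ·) e1 <| congrArg₂ (· + ·) e2 <| congrArg₂ (· + ·) e3 <|
          congrArg₂ (· + ·) e4 <| congrArg₂ (· + ·) e5 <| congrArg₂ (· + ·) e6 e7
        simp only [add_zero] at e
        rw [← e]
        abel
  have H : (stuffle.compr₂ stuffle : WordAlg L →ₗ[ℚ] WordAlg L →ₗ[ℚ] WordAlg L →ₗ[ℚ] WordAlg L) =
      ((LinearMap.lcomp ℚ (WordAlg L →ₗ[ℚ] WordAlg L) stuffle).comp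
        ((LinearMap.llcomp ℚ (WordAlg L) (WordAlg L) (WordAlg L)).comp stuffle)) := by
    refine hom_ext fun w => hom_ext fun v => hom_ext fun u => ?_
    exact key _ w v u rfl
  exact congrArg (fun F => F f g h) H

instance : CommRing (WordAlg L) :=
  { (inferInstance : AddCommGroup (WordAlg L)) with
    mul := fun f g => stuffle f g
    one := word []
    left_distrib := fun f g h => map_add (stuffle f) g h
    right_distrib := fun f g h => LinearMap.map_add₂ stuffle f g h
    zero_mul := fun f => LinearMap.map_zero₂ stuffle f
    mul_zero := fun f => map_zero (stuffle f)
    mul_assoc := stuffle_assoc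
    mul_comm := stuffle_comm
    one_mul := nil_stuffle
    mul_one := stuffle_nil }

instance : Algebra ℚ (WordAlg L) :=
  Algebra.ofModule (fun c f g => LinearMap.map_smul₂ stuffle c f g)
    (fun c f g => map_smul (stuffle f) c g)

end stuffle

end WordAlg

open WordAlg

/-! ### Formal multiple Eisenstein series -/

/-- The alphabet of letters `[k; d]` with `k ≥ 1` and `d ≥ 0`; the sum of letters is
`[k₁ + k₂; d₁ + d₂]`. -/
abbrev BiLetter : Type := ℕ+ × ℕ

/-- `ℚ⟨A⟩` with the stuffle product. -/
abbrev QA : Type := WordAlg BiLetter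

/-- Power series in `X₁, …, X_r` (the left summand of the index type) and
`Y₁, …, Y_r` (the right summand). -/
abbrev BiSeries (r : ℕ) (R : Type) : Type := MvPowerSeries (Fin r ⊕ Fin r) R

section swap

variable (R : Type) [CommRing R] (r : ℕ)

/-- The variable `X_{i+1}`, with the convention that it is `0` for `i ≥ r`. -/
def varX (i : ℕ) : BiSeries r R :=
  if h : i < r then MvPowerSeries.X (Sum.inl ⟨i, h⟩) else 0

/-- The change of variables of the swap, with variables numbered from `1`:
`X_j ↦ Y_1 + ⋯ + Y_{r-j+1}` and `Y_j ↦ X_{r-j+1} - X_{r-j+2}`, where `X_{r+1} = 0`. -/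
def swapVar : Fin r ⊕ Fin r → BiSeries r R
  | Sum.inl j =>
      ∑ i ∈ Finset.univ.filter (fun i : Fin r => (i : ℕ) + (j : ℕ) < r), MvPowerSeries.X (Sum.inr i)
  | Sum.inr j => varX R r (r - 1 - j) - varX R r (r - j)

theorem hasSubst_swapVar : MvPowerSeries.HasSubst (swapVar R r) := by
  apply MvPowerSeries.hasSubst_of_constantCoeff_zero
  rintro (j | j)
  · simp [swapVar]
  · simp only [swapVar, varX]
    split_ifs <;> simp

variable {R r}

/-- The swap of a power series. -/
def swapSeries (f : BiSeries r R) : BiSeries r R := MvPowerSeries.subst (swapVar R r) f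

end swap

/-- The word whose letters are `[e(X_i) + 1; e(Y_i)]`. -/
def wordOfExp {r : ℕ} (e : Fin r ⊕ Fin r →₀ ℕ) : List BiLetter :=
  List.ofFn fun i : Fin r => ((e (Sum.inl i)).succPNat, e (Sum.inr i))

/-- The generating series
`∑ [k₁,…,k_r; d₁,…,d_r] X₁^(k₁-1) ⋯ X_r^(k_r-1) (Y₁^d₁ / d₁!) ⋯ (Y_r^d_r / d_r!)`
of all words of length `r`. -/
def genSeries (r : ℕ) : BiSeries r QA := fun e =>
  (∏ i : Fin r, ((e (Sum.inr i)).factorial : ℚ))⁻¹ • word (wordOfExp e)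

/-- The exponent of the monomial `∏ X_i^(k_i - 1) Y_i^(d_i)` attached to a word. -/
def expOfWord (w : List BiLetter) : Fin w.length ⊕ Fin w.length →₀ ℕ :=
  Finsupp.equivFunOnFinite.symm
    (Sum.elim (fun i => (w.get i).1.natPred) (fun i => (w.get i).2))

/-- The coefficient of `∏ X_i^(e(X_i)) Y_i^(e(Y_i)) / e(Y_i)!` in the swap of the generating
series of words of length `r`. -/
def swapCoeff {r : ℕ} (e : Fin r ⊕ Fin r →₀ ℕ) : QA :=
  (∏ i : Fin r, ((e (Sum.inr i)).factorial : ℚ)) •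
    MvPowerSeries.coeff e (swapSeries (genSeries r))

/-- The swap of the word `[k₁,…,k_r; d₁,…,d_r]`: the coefficient of
`∏ X_i^(k_i - 1) Y_i^(d_i) / d_i!` in the swap of the generating series. -/
def swapWord (w : List BiLetter) : QA := swapCoeff (expOfWord w)

/-- The swap as a linear map on `ℚ⟨A⟩`. -/
def swap : QA →ₗ[ℚ] QA := lift swapWord

/-- The ideal of `(ℚ⟨A⟩, ∗)` generated by all `σ(w) - w`. -/
def swapIdeal : Ideal QA := Ideal.span {f | ∃ w : QA, f = swap w - w}

/-- The algebra of formal multiple Eisenstein series. -/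
abbrev FMES : Type := QA ⧸ swapIdeal

/-- The formal multiple Eisenstein series with bi-index `w`. -/
def Gf (w : List BiLetter) : FMES := Ideal.Quotient.mk swapIdeal (word w)

/-- `G^f(k₁, …, k_r) = G^f(k₁, …, k_r; 0, …, 0)`. -/
def Gf₀ (k : List ℕ+) : FMES := Gf (k.map fun i => (i, 0))

/-- The bi-index has the shape `(1, …, 1, k₁, …, k_r; d₁, …, d_s, 0, …, 0)` with `r, s ≥ 0`. -/
def IsSpecial (w : List BiLetter) : Prop :=
  ∃ u v : List BiLetter, w = u ++ v ∧ (∀ a ∈ u, a.1 = 1) ∧ (∀ a ∈ v, a.2 = 0)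

/-- The ideal generated by all formal multiple Eisenstein series whose bi-index does not have
the special shape. -/
def idealN : Ideal FMES := Ideal.span {g | ∃ w : List BiLetter, ¬ IsSpecial w ∧ g = Gf w}

/-! ### Formal multiple zeta values -/

/-- The space `𝔥¹ = ℚ⟨z₁, z₂, …⟩` with the stuffle product; the letter `z_k` is the positive
integer `k`. -/
abbrev H1 : Type := WordAlg ℕ+

/-- The subspace of `𝔥¹` spanned by all words that do not start with `z₁`. -/
def H0 : Submodule ℚ H1 := Submodule.span ℚ {f | ∃ w : List ℕ+, w.head? ≠ some 1 ∧ f = word w}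

/-- The two letters `x` and `y`. -/
inductive XY : Type
  | x : XY
  | y : XY

/-- The shuffle product of two words: `a w ⧢ b v = a (w ⧢ b v) + b (a w ⧢ v)`. -/
def shuffleWord {L : Type} : List L → List L → WordAlg L
  | [], v => word v
  | a :: w, [] => word (a :: w)
  | a :: w, b :: v => cons a (shuffleWord w (b :: v)) + cons b (shuffleWord (a :: w) v)
  termination_by w v => w.length + v.length

/-- The bilinear extension of the shuffle product of words. -/
def shuffle {L : Type} : WordAlg L →ₗ[ℚ] WordAlg L →ₗ[ℚ] WordAlg L :=
  lift fun w => lift fun v => shuffleWord w v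

/-- The word in `x, y` obtained from a word in the `z_k` by `z_k = x^(k-1) y`. -/
def encodeWord (w : List ℕ+) : List XY :=
  w.flatMap fun k => List.replicate k.natPred XY.x ++ [XY.y]

/-- The word in the `z_k` obtained by reading `x^(n-1) w`, where a block `x^(k-1) y` is read
as `z_k`. -/
def decodeAux : ℕ+ → List XY → List ℕ+
  | _, [] => []
  | n, XY.x :: w => decodeAux (n + 1) w
  | n, XY.y :: w => n :: decodeAux 1 w

/-- The embedding of `𝔥¹` into `𝔥 = ℚ⟨x, y⟩` with `z_k = x^(k-1) y`. -/
def encode : H1 →ₗ[ℚ] WordAlg XY := lift fun w => word (encodeWord w)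

/-- A left inverse of the embedding of `𝔥¹` into `𝔥`. -/
def decode : WordAlg XY →ₗ[ℚ] H1 := lift fun w => word (decodeAux 1 w)

/-- The shuffle product on `𝔥¹`, viewed as a subspace of `ℚ⟨x, y⟩`. -/
def shuffleH1 (f g : H1) : H1 := decode (shuffle (encode f) (encode g))

section closed

theorem shuffleWord_mem : ∀ w v : List XY,
    (w = [] ∨ ∃ u, w = u ++ [XY.y]) → (v = [] ∨ ∃ u, v = u ++ [XY.y]) → (w ≠ [] ∨ v ≠ []) →
      shuffleWord w v ∈ Submodule.span ℚ {f : WordAlg XY | ∃ u, f = word (u ++ [XY.y])} := by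
  have hcons : ∀ (a : XY) (f : WordAlg XY),
      f ∈ Submodule.span ℚ {f : WordAlg XY | ∃ u, f = word (u ++ [XY.y])} →
      cons a f ∈ Submodule.span ℚ {f : WordAlg XY | ∃ u, f = word (u ++ [XY.y])} := by
    intro a f hf
    induction hf using Submodule.span_induction with
    | mem f hf =>
      obtain ⟨u, rfl⟩ := hf
      exact Submodule.subset_span ⟨a :: u, by simp⟩
    | zero => simp
    | add f g _ _ hf hg => rw [map_add]; exact add_mem hf hg
    | smul c f _ hf => rw [map_smul]; exact Submodule.smul_mem _ c hf
  have htail : ∀ (a : XY) (w : List XY), (a :: w = [] ∨ ∃ u, a :: w = u ++ [XY.y]) →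
      (w = [] ∨ ∃ u, w = u ++ [XY.y]) := by
    rintro a w (h | ⟨u, hu⟩)
    · simp at h
    · cases u with
      | nil => left; simp_all
      | cons b u => right; exact ⟨u, by simp_all⟩
  have key : ∀ n : ℕ, ∀ w v : List XY, w.length + v.length = n →
      (w = [] ∨ ∃ u, w = u ++ [XY.y]) → (v = [] ∨ ∃ u, v = u ++ [XY.y]) → (w ≠ [] ∨ v ≠ []) →
      shuffleWord w v ∈ Submodule.span ℚ {f : WordAlg XY | ∃ u, f = word (u ++ [XY.y])} := by
    intro n
    induction n using Nat.strong_induction_on with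
    | _ n ih =>
      intro w v hn hw hv hwv
      match w, v with
      | [], [] => simp at hwv
      | [], b :: v =>
        rw [shuffleWord]
        obtain h | ⟨u, hu⟩ := hv
        · simp at h
        · exact Submodule.subset_span ⟨u, by rw [hu]⟩
      | a :: w, [] =>
        rw [shuffleWord]
        obtain h | ⟨u, hu⟩ := hw
        · simp at h
        · exact Submodule.subset_span ⟨u, by rw [hu]⟩
      | a :: w, b :: v =>
        simp only [List.length_cons] at hn
        rw [shuffleWord]
        exact add_mem
          (hcons a _ (ih _ (by simp; omega) w (b :: v) rfl (htail a w hw) hv (by simp)))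
          (hcons b _ (ih _ (by simp; omega) (a :: w) v rfl hw (htail b v hv) (by simp)))
  exact fun w v => key _ w v rfl

theorem encodeWord_decodeAux (u : List XY) : ∀ n : ℕ+,
    encodeWord (decodeAux n (u ++ [XY.y])) = List.replicate n.natPred XY.x ++ (u ++ [XY.y]) := by
  induction u with
  | nil => intro n; simp [decodeAux, encodeWord]
  | cons a u ih =>
    intro n
    cases a with
    | x =>
      have h : (n + 1).natPred = n.natPred + 1 := by
        have h1 := PNat.natPred_add_one n
        have h2 := PNat.natPred_add_one (n + 1)
        rw [PNat.add_coe, PNat.one_coe] at h2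
        omega
      rw [List.cons_append, decodeAux, ih, h, List.replicate_succ']
      simp
    | y =>
      have := ih 1
      simp only [List.cons_append, decodeAux, encodeWord, List.flatMap_cons] at this ⊢
      rw [this]
      simp [PNat.natPred]

theorem encodeWord_shape (w : List ℕ+) : encodeWord w = [] ∨ ∃ u, encodeWord w = u ++ [XY.y] := by
  induction w using List.reverseRecOn with
  | nil => left; rfl
  | append_singleton w k _ =>
    right
    exact ⟨encodeWord w ++ List.replicate k.natPred XY.x, by simp [encodeWord]⟩

/-- The image of `𝔥¹` in `ℚ⟨x, y⟩` is closed under the shuffle product, and `shuffleH1` is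
the restriction of the shuffle product to it. -/
theorem encode_shuffleH1 (f g : H1) : encode (shuffleH1 f g) = shuffle (encode f) (encode g) := by
  have hid : ∀ h ∈ Submodule.span ℚ {f : WordAlg XY | ∃ u, f = word (u ++ [XY.y])},
      encode (decode h) = h := by
    intro h hh
    induction hh using Submodule.span_induction with
    | mem f hf =>
      obtain ⟨u, rfl⟩ := hf
      simp [encode, decode, encodeWord_decodeAux, PNat.natPred]
    | zero => simp
    | add f g _ _ hf hg => simp [hf, hg]
    | smul c f _ hf => simp [hf]
  have H : (((shuffle.compl₁₂ encode encode).compr₂ decode).compr₂ encode :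
      H1 →ₗ[ℚ] H1 →ₗ[ℚ] WordAlg XY) = shuffle.compl₁₂ encode encode := by
    refine hom_ext fun w => hom_ext fun v => ?_
    have e : shuffle (encode (word w)) (encode (word v)) =
        shuffleWord (encodeWord w) (encodeWord v) := by simp [encode, shuffle]
    simp only [LinearMap.compr₂_apply, LinearMap.compl₁₂_apply, e]
    by_cases hwv : encodeWord w ≠ [] ∨ encodeWord v ≠ []
    · exact hid _ (shuffleWord_mem _ _ (encodeWord_shape w) (encodeWord_shape v) hwv)
    · push Not at hwv
      rw [hwv.1, hwv.2, shuffleWord]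
      simp [decode, decodeAux, encode, encodeWord]
  exact congrArg (fun F => F f g) H

/-- The embedding of `𝔥¹` into `ℚ⟨x, y⟩` is injective. -/
theorem decode_encode (f : H1) : decode (encode f) = f := by
  have h1 : ∀ (m : ℕ) (n : ℕ+) (u : List XY),
      decodeAux n (List.replicate m XY.x ++ (XY.y :: u)) =
        (⟨n + m, by positivity⟩ : ℕ+) :: decodeAux 1 u := by
    intro m
    induction m with
    | zero => intro n u; rfl
    | succ m ih =>
      intro n u
      rw [List.replicate_succ, List.cons_append, decodeAux, ih]
      congr 1
      apply PNat.eq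
      simp
      ring
  have h2 : ∀ w : List ℕ+, decodeAux 1 (encodeWord w) = w := by
    intro w
    induction w with
    | nil => rfl
    | cons k w ih =>
      have : encodeWord (k :: w) = List.replicate k.natPred XY.x ++ (XY.y :: encodeWord w) := by
        simp [encodeWord]
      rw [this, h1, ih]
      congr 1
      apply PNat.eq
      have := PNat.natPred_add_one k
      simp
  have H : decode.comp encode = LinearMap.id := by
    refine hom_ext fun w => ?_
    simp [encode, decode, h2]
  exact congrArg (fun F => F f) H

end closed

/-- The ideal of `(𝔥¹, ∗)` generated by the extended double shuffle relations
`w ∗ v - w ⧢ v` with `w ∈ 𝔥¹` and `v ∈ 𝔥⁰`. -/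
def edsIdeal : Ideal H1 :=
  Ideal.span {f | ∃ w v : H1, v ∈ H0 ∧ f = w * v - shuffleH1 w v}

/-- The algebra of formal multiple zeta values. -/
abbrev FMZV : Type := H1 ⧸ edsIdeal

/-- The formal multiple zeta value `ζ^f(k₁, …, k_r)`. -/
def zetaf (k : List ℕ+) : FMZV := Ideal.Quotient.mk edsIdeal (word k)

end

end FormalMES

/-! The quotient of `FMES` by `idealN` and `FMZV` determine each other, because a character of `QA`
that kills the non-special words and is swap invariant is the same thing as a character of `H1`
satisfying extended double shuffle.

From zeta values to Eisenstein series. For words `d = d₁⋯d_r`, `toH1` is the change of variables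
z_{k₁}⋯z_{k_r} ↦ (Y₁+⋯+Y_r)^(k₁-1)⋯Y₁^(k_r-1) in coordinates. It turns the shuffle of the letters d
into the shuffle of `H1` (`toH1_shuffle`), since removal of a first x or y corresponds to the two
derivations `lower` and `dropZero`. For Z : H1 → FMZV the functional P = Z ∘ `toH1` is
multiplicative only when one factor is killed by `dropZero`, as only then does an argument lie in
H⁰. Regularization repairs this: dividing by the series of the values P(0ⁿ) makes P a genuine
shuffle character that vanishes on 0ⁿ for n > 0 (`exists_twist_shuffle`). Modulo letters with k > 1,
the stuffle of words [1,…,1;d] is a shuffle, so this gives a character of `QA`; the words [k;0]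
carry Z. The convolution of the two is a character by compatibility of deconcatenation with stuffle.
It kills non-special words and restricts to Z on the words [k;0]. Its generating series is a sum of
products h_j · F(Y₁+⋯+Y_m,…,Y₁) · F(X_{r-l+1},…,X_r) with m + j + l = r (`gSeries_conv`), and the
swap exchanges the two factors F, so the sum is invariant. This gives π and its surjectivity.

From Eisenstein series to zeta values. Let G be the projection of `QA` to `FMES` modulo `idealN`.
Swap invariance at X = 0 forces G[1,…,1;d] to be the value of G at `toH1 d`, placed on words [k;0]
(`map_ones_of_swap`). In a stuffle of two words [1,…,1;d], one of which does not end in d = 0, every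
contracted term is non-special, so only the shuffle survives. Since `toH1` is onto and maps the
kernel of `dropZero` onto H⁰, this yields extended double shuffle for the words [k;0]
(`map_zerosIncl_eds`). Finally these words already generate the image of G
(`map_mem_range_zerosIncl`): a special word is reached by multiplying its two halves and discarding
non-special terms. So an element of ker π equals, modulo `idealN`, a combination of words [k;0]
lying in `edsIdeal`, hence is zero. -/

namespace FormalMES

noncomputable section

open WordAlg

/-! ### Generalities on word algebras -/

namespace WordAlg

variable {L L' : Type} {M : Type} [AddCommGroup M] [Module ℚ M]

theorem hom_ext₂ {f g : WordAlg L →ₗ[ℚ] WordAlg L' →ₗ[ℚ] M}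
    (h : ∀ w v, f (word w) (word v) = g (word w) (word v)) : f = g :=
  hom_ext fun w => hom_ext fun v => h w v

theorem span_word : Submodule.span ℚ (Set.range (word : List L → WordAlg L)) = ⊤ := by
  rw [eq_top_iff]
  rintro f -
  have : f = f.sum fun w c => c • (word w : WordAlg L) := by
    conv_lhs => rw [← Finsupp.sum_single f]
    refine Finsupp.sum_congr fun w _ => ?_
    exact (Finsupp.smul_single_one w _).symm
  rw [this]
  exact Submodule.sum_mem _ fun w _ => Submodule.smul_mem _ _ (Submodule.subset_span ⟨w, rfl⟩)

theorem induction_on {p : WordAlg L → Prop} (f : WordAlg L) (hw : ∀ w, p (word w))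
    (hadd : ∀ f g, p f → p g → p (f + g)) (hsmul : ∀ (c : ℚ) f, p f → p (c • f)) : p f := by
  have hf : f ∈ Submodule.span ℚ (Set.range (word : List L → WordAlg L)) := by
    rw [span_word]; trivial
  induction hf using Submodule.span_induction with
  | mem f hf => obtain ⟨w, rfl⟩ := hf; exact hw w
  | zero => simpa using hsmul 0 _ (hw [])
  | add f g _ _ hf hg => exact hadd f g hf hg
  | smul c f _ hf => exact hsmul c f hf

/-- The coefficient of the empty word. -/
def eps : WordAlg L →ₗ[ℚ] ℚ := lift fun
  | [] => 1
  | _ :: _ => 0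

@[simp] theorem eps_nil : eps (word ([] : List L)) = 1 := by simp [eps]

@[simp] theorem eps_cons (a : L) (f : WordAlg L) : eps (cons a f) = 0 := by
  have : eps ∘ₗ cons a = 0 := hom_ext fun w => by simp [eps]
  exact congrArg (fun F => F f) this

/-- Appending the letter `a` to every word. -/
def snoc (a : L) : WordAlg L →ₗ[ℚ] WordAlg L := lift fun w => word (w ++ [a])

@[simp] theorem snoc_word (a : L) (w : List L) : snoc a (word w) = word (w ++ [a]) := by
  simp [snoc]

@[simp] theorem eps_snoc (a : L) (f : WordAlg L) : eps (snoc a f) = 0 := by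
  have : eps ∘ₗ snoc a = 0 := hom_ext fun w => by cases w <;> simp [eps]
  exact congrArg (fun F => F f) this

theorem snoc_cons (a b : L) (f : WordAlg L) : snoc b (cons a f) = cons a (snoc b f) := by
  have : snoc b ∘ₗ cons a = cons a ∘ₗ snoc b := hom_ext fun w => by simp
  exact congrArg (fun F => F f) this

end WordAlg

/-! ### The shuffle algebra -/

section shuffle

variable {L : Type}

theorem shuffle_word (w v : List L) : shuffle (word w) (word v) = shuffleWord w v := by
  simp [shuffle]

@[simp] theorem nil_shuffle (f : WordAlg L) : shuffle (word []) f = f := by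
  have : shuffle (word ([] : List L)) = LinearMap.id :=
    hom_ext fun w => by simp [shuffle_word, shuffleWord]
  simp [this]

@[simp] theorem shuffle_nil (f : WordAlg L) : shuffle f (word []) = f := by
  have : shuffle.flip (word ([] : List L)) = LinearMap.id :=
    hom_ext fun w => by cases w <;> simp [shuffle_word, shuffleWord]
  exact congrArg (fun F => F f) this

theorem shuffle_cons_cons (a b : L) (f g : WordAlg L) :
    shuffle (cons a f) (cons b g) =
      cons a (shuffle f (cons b g)) + cons b (shuffle (cons a f) g) := by
  have h : (shuffle.compl₁₂ (cons a) (cons b) : WordAlg L →ₗ[ℚ] WordAlg L →ₗ[ℚ] WordAlg L) =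
      (shuffle.compl₁₂ LinearMap.id (cons b)).compr₂ (cons a)
        + (shuffle.compl₁₂ (cons a) LinearMap.id).compr₂ (cons b) := by
    refine hom_ext₂ fun w v => ?_
    simp [shuffle_word, shuffleWord]
  exact congrArg (fun F => F f g) h

/-- To prove a property of pairs of words it suffices to treat pairs with an empty member and to
pass from `(w, b v)`, `(a w, v)` and `(w, v)` to `(a w, b v)`. -/
theorem pair_induction {L' : Type} {p : List L → List L' → Prop} (hl : ∀ v, p [] v)
    (hr : ∀ w, p w [])
    (h : ∀ a w b v, p w (b :: v) → p (a :: w) v → p w v → p (a :: w) (b :: v)) :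
    ∀ w v, p w v := by
  intro w
  induction w with
  | nil => exact hl
  | cons a w ihw =>
    intro v
    induction v with
    | nil => exact hr _
    | cons b v ihv => exact h a w b v (ihw _) ihv (ihw _)

theorem shuffle_comm (f g : WordAlg L) : shuffle f g = shuffle g f := by
  have h : (shuffle : WordAlg L →ₗ[ℚ] _) = shuffle.flip := by
    refine hom_ext₂ fun w v => ?_
    simp only [LinearMap.flip_apply]
    induction w, v using pair_induction with
    | hl v => simp
    | hr w => simp
    | h a w b v h1 h2 _ =>
      simp only [← cons_word] at h1 h2 ⊢
      rw [shuffle_cons_cons, shuffle_cons_cons, h1, h2, add_comm]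
  exact congrArg (fun F => F f g) h

theorem shuffle_assoc (f g h : WordAlg L) :
    shuffle (shuffle f g) h = shuffle f (shuffle g h) := by
  have key : ∀ w v u : List L, shuffle (shuffle (word w) (word v)) (word u) =
      shuffle (word w) (shuffle (word v) (word u)) := by
    intro w
    induction w with
    | nil => simp
    | cons a w ihw =>
      refine pair_induction (by simp) (by simp) fun b v c u h2 h3 _ => ?_
      have h1 := ihw (b :: v) (c :: u)
      simp only [← cons_word, shuffle_cons_cons, map_add, LinearMap.add_apply] at h1 h2 h3 ⊢
      rw [h1, h2, ← add_assoc, ← h3]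
      simp only [map_add]
      abel
  have H : (shuffle.compr₂ shuffle : WordAlg L →ₗ[ℚ] WordAlg L →ₗ[ℚ] WordAlg L →ₗ[ℚ] WordAlg L) =
      ((LinearMap.lcomp ℚ (WordAlg L →ₗ[ℚ] WordAlg L) shuffle).comp
        ((LinearMap.llcomp ℚ (WordAlg L) (WordAlg L) (WordAlg L)).comp shuffle)) :=
    hom_ext fun w => hom_ext fun v => hom_ext fun u => key w v u
  exact congrArg (fun F => F f g h) H

theorem eps_shuffle (f g : WordAlg L) : eps (shuffle f g) = eps f * eps g := by
  have h : (shuffle.compr₂ eps : WordAlg L →ₗ[ℚ] WordAlg L →ₗ[ℚ] ℚ) =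
      (LinearMap.mul ℚ ℚ).compl₁₂ eps eps := by
    refine hom_ext₂ fun w v => ?_
    simp only [LinearMap.compr₂_apply, LinearMap.compl₁₂_apply, LinearMap.mul_apply']
    cases w with
    | nil => simp
    | cons a w =>
      cases v with
      | nil => simp
      | cons b v => rw [← cons_word, ← cons_word, shuffle_cons_cons, map_add]; simp [-cons_word]
  exact congrArg (fun F => F f g) h

/-- A linear map which is a derivation on words is a derivation for the shuffle product. -/
theorem derivation_of_word {δ : WordAlg L →ₗ[ℚ] WordAlg L}
    (h : ∀ w v, δ (shuffle (word w) (word v)) =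
      shuffle (δ (word w)) (word v) + shuffle (word w) (δ (word v))) (f g : WordAlg L) :
    δ (shuffle f g) = shuffle (δ f) g + shuffle f (δ g) := by
  have H : (shuffle.compr₂ δ : WordAlg L →ₗ[ℚ] WordAlg L →ₗ[ℚ] WordAlg L) =
      shuffle.compl₁₂ δ LinearMap.id + shuffle.compl₁₂ LinearMap.id δ :=
    hom_ext₂ h
  exact congrArg (fun F => F f g) H

end shuffle

/-! ### Two derivations of the shuffle algebra on the letters `0, 1, 2, …` -/

/-- The derivation `d ↦ d · (d - 1)` on words. -/
def lowerWord : List ℕ → WordAlg ℕ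
  | [] => 0
  | a :: w => (a : ℚ) • word ((a - 1) :: w) + cons a (lowerWord w)

/-- The derivation of the concatenation and of the shuffle product with `d ↦ d · (d - 1)` on
letters. -/
def lower : WordAlg ℕ →ₗ[ℚ] WordAlg ℕ := lift lowerWord

/-- Deleting the last letter if it is `0`; words which do not end in `0` are mapped to zero. -/
def dropZeroWord : List ℕ → WordAlg ℕ
  | [] => 0
  | [a] => if a = 0 then word [] else 0
  | a :: b :: w => cons a (dropZeroWord (b :: w))

/-- The linear map deleting a last letter `0` and killing all words which do not end in `0`. -/
def dropZero : WordAlg ℕ →ₗ[ℚ] WordAlg ℕ := lift dropZeroWord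

@[simp] theorem lower_nil : lower (word []) = 0 := by simp [lower, lowerWord]

@[simp] theorem dropZero_nil : dropZero (word []) = 0 := by simp [dropZero, dropZeroWord]

theorem lower_cons (a : ℕ) (f : WordAlg ℕ) :
    lower (cons a f) = (a : ℚ) • cons (a - 1) f + cons a (lower f) := by
  have : lower ∘ₗ cons a = (a : ℚ) • cons (a - 1) + cons a ∘ₗ lower :=
    hom_ext fun w => by simp [lower, lowerWord]
  exact congrArg (fun F => F f) this

theorem dropZero_cons (a : ℕ) (f : WordAlg ℕ) :
    dropZero (cons a f) = cons a (dropZero f) + (if a = 0 then eps f else 0) • word [] := by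
  have : dropZero ∘ₗ cons a =
      cons a ∘ₗ dropZero + (if a = 0 then eps else 0 : WordAlg ℕ →ₗ[ℚ] ℚ).smulRight (word []) := by
    refine hom_ext fun w => ?_
    cases w with
    | nil => by_cases h : a = 0 <;> simp [dropZero, dropZeroWord, h]
    | cons b w => by_cases h : a = 0 <;> simp [dropZero, dropZeroWord, h, eps]
  refine (congrArg (fun F => F f) this).trans ?_
  by_cases h : a = 0 <;> simp [h]

/-- A shuffle only interleaves letters, so an operator acting on one letter at a time obeys the
Leibniz rule. In generating series, `lower` is multiplication by Y₁ + ⋯ + Y_r. -/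
theorem lower_shuffle (f g : WordAlg ℕ) :
    lower (shuffle f g) = shuffle (lower f) g + shuffle f (lower g) := by
  refine derivation_of_word (fun w v => ?_) f g
  induction w, v using pair_induction with
  | hl v => simp
  | hr w => simp
  | h a w b v h1 h2 _ =>
    simp only [← cons_word] at h1 h2 ⊢
    simp only [shuffle_cons_cons, map_add, lower_cons, h1, h2, LinearMap.add_apply, map_smul,
      LinearMap.smul_apply]
    module

/-- The last letter of a shuffled word is the last letter of one of the two factors. The induction
runs on first letters, so the `eps` terms account for the moment when a letter is both first and
last. -/
theorem dropZero_shuffle (f g : WordAlg ℕ) :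
    dropZero (shuffle f g) = shuffle (dropZero f) g + shuffle f (dropZero g) := by
  refine derivation_of_word (fun w v => ?_) f g
  induction w, v using pair_induction with
  | hl v => simp
  | hr w => simp
  | h a w b v h1 h2 _ =>
    simp only [← cons_word] at h1 h2 ⊢
    simp only [shuffle_cons_cons, map_add, dropZero_cons, h1, h2, LinearMap.add_apply, map_smul,
      LinearMap.smul_apply, eps_shuffle, eps_cons, nil_shuffle, shuffle_nil, mul_zero, zero_mul,
      ite_self]
    module

theorem lower_snoc (d : ℕ) (f : WordAlg ℕ) :
    lower (snoc d f) = snoc d (lower f) + (d : ℚ) • snoc (d - 1) f := by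
  have : lower ∘ₗ snoc d = snoc d ∘ₗ lower + (d : ℚ) • snoc (d - 1) := by
    refine hom_ext fun w => ?_
    induction w with
    | nil => simp [lower, lowerWord]
    | cons a w ih =>
      simp only [LinearMap.comp_apply, LinearMap.add_apply, LinearMap.smul_apply, ← cons_word]
        at ih ⊢
      rw [snoc_cons, lower_cons, ih, lower_cons]
      simp only [map_add, map_smul, snoc_cons]
      module
  exact congrArg (fun F => F f) this

theorem dropZero_snoc (d : ℕ) (f : WordAlg ℕ) :
    dropZero (snoc d f) = if d = 0 then f else 0 := by
  have : dropZero ∘ₗ snoc d = if d = 0 then LinearMap.id else 0 := by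
    refine hom_ext fun w => ?_
    induction w with
    | nil => by_cases h : d = 0 <;> simp [dropZero, dropZeroWord, h]
    | cons a w ih =>
      simp only [LinearMap.comp_apply, snoc_word] at ih ⊢
      rw [List.cons_append, ← cons_word, dropZero_cons, ih, ← snoc_word, eps_snoc]
      by_cases h : d = 0 <;> simp [h]
  refine (congrArg (fun F => F f) this).trans ?_
  by_cases h : d = 0 <;> simp [h]

theorem eps_lower (f : WordAlg ℕ) : eps (lower f) = 0 := by
  have : eps ∘ₗ lower = 0 := hom_ext fun w => by
    cases w with
    | nil => simp
    | cons a w => rw [← cons_word, LinearMap.comp_apply, lower_cons]; simp [-cons_word]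
  exact congrArg (fun F => F f) this

/-! ### The weight filtration -/

/-- The span of the words of length plus letter sum smaller than `n`. -/
def weightLT (n : ℕ) : Submodule ℚ (WordAlg ℕ) :=
  Submodule.span ℚ {f | ∃ w : List ℕ, w.length + w.sum < n ∧ f = word w}

theorem word_mem_weightLT {w : List ℕ} {n : ℕ} (h : w.length + w.sum < n) :
    (word w : WordAlg ℕ) ∈ weightLT n :=
  Submodule.subset_span ⟨w, h, rfl⟩

theorem weightLT_mono {m n : ℕ} (h : m ≤ n) : weightLT m ≤ weightLT n :=
  Submodule.span_mono fun _ ⟨w, hw, e⟩ => ⟨w, hw.trans_le h, e⟩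

theorem eq_zero_of_mem_weightLT_zero {f : WordAlg ℕ} (h : f ∈ weightLT 0) : f = 0 := by
  have : {f : WordAlg ℕ | ∃ w : List ℕ, w.length + w.sum < 0 ∧ f = word w} = ∅ := by ext; simp
  rwa [weightLT, this, Submodule.span_empty, Submodule.mem_bot] at h

theorem cons_mem_weightLT (a : ℕ) {n : ℕ} {f : WordAlg ℕ} (h : f ∈ weightLT n) :
    cons a f ∈ weightLT (n + a + 1) := by
  suffices weightLT n ≤ (weightLT (n + a + 1)).comap (cons a) from this h
  refine Submodule.span_le.2 ?_
  rintro _ ⟨w, hw, rfl⟩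
  simp only [SetLike.mem_coe, Submodule.mem_comap, cons_word]
  exact word_mem_weightLT (by simp; omega)

theorem lowerWord_mem (w : List ℕ) : lowerWord w ∈ weightLT (w.length + w.sum) := by
  induction w with
  | nil => exact zero_mem _
  | cons a w ih =>
    rw [lowerWord]
    refine add_mem ?_ (weightLT_mono (by simp only [List.length_cons, List.sum_cons]; omega)
      (cons_mem_weightLT a ih))
    cases a with
    -- Here the truncated `a - 1` would not lower the weight, but the coefficient `a` is zero.
    | zero => simp
    | succ a =>
      exact Submodule.smul_mem _ _ (word_mem_weightLT (by
        simp only [List.length_cons, List.sum_cons]; omega))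

theorem dropZeroWord_mem (w : List ℕ) : dropZeroWord w ∈ weightLT (w.length + w.sum) := by
  induction w with
  | nil => exact zero_mem _
  | cons a w ih =>
    cases w with
    | nil =>
      rw [dropZeroWord]
      split_ifs
      · exact word_mem_weightLT (by simp)
      · exact zero_mem _
    | cons b w =>
      rw [dropZeroWord]
      exact weightLT_mono (by simp; omega) (cons_mem_weightLT a ih)

theorem map_mem_weightLT {f : List ℕ → WordAlg ℕ} (hf : ∀ w, f w ∈ weightLT (w.length + w.sum))
    {n : ℕ} {g : WordAlg ℕ} (hg : g ∈ weightLT (n + 1)) : lift f g ∈ weightLT n := by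
  suffices weightLT (n + 1) ≤ (weightLT n).comap (lift f) from this hg
  refine Submodule.span_le.2 ?_
  rintro _ ⟨w, hw, rfl⟩
  simp only [SetLike.mem_coe, Submodule.mem_comap, lift_word]
  exact weightLT_mono (by omega) (hf w)

theorem lower_mem_weightLT {n : ℕ} {f : WordAlg ℕ} (h : f ∈ weightLT (n + 1)) :
    lower f ∈ weightLT n :=
  map_mem_weightLT lowerWord_mem h

theorem dropZero_mem_weightLT {n : ℕ} {f : WordAlg ℕ} (h : f ∈ weightLT (n + 1)) :
    dropZero f ∈ weightLT n :=
  map_mem_weightLT dropZeroWord_mem h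

theorem exists_mem_weightLT (f : WordAlg ℕ) : ∃ n, f ∈ weightLT n := by
  induction f using WordAlg.induction_on with
  | hw w => exact ⟨_, word_mem_weightLT (Nat.lt_succ_self _)⟩
  | hadd f g hf hg =>
    obtain ⟨n, hn⟩ := hf
    obtain ⟨m, hm⟩ := hg
    exact ⟨max n m, add_mem (weightLT_mono (le_max_left _ _) hn)
      (weightLT_mono (le_max_right _ _) hm)⟩
  | hsmul c f hf =>
    obtain ⟨n, hn⟩ := hf
    exact ⟨n, Submodule.smul_mem _ _ hn⟩

theorem exists_lower_iterate_eq_zero (f : WordAlg ℕ) : ∃ n, lower^[n] f = 0 := by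
  obtain ⟨n, hn⟩ := exists_mem_weightLT f
  refine ⟨n, ?_⟩
  induction n generalizing f with
  | zero => exact eq_zero_of_mem_weightLT_zero hn
  | succ n ih => exact ih _ (lower_mem_weightLT hn)

theorem exists_dropZero_iterate_eq_zero (f : WordAlg ℕ) : ∃ n, dropZero^[n] f = 0 := by
  obtain ⟨n, hn⟩ := exists_mem_weightLT f
  refine ⟨n, ?_⟩
  induction n generalizing f with
  | zero => exact eq_zero_of_mem_weightLT_zero hn
  | succ n ih => exact ih _ (dropZero_mem_weightLT hn)

/-! ### From words in `0, 1, 2, …` to words in `x` and `y` -/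

/-- The map `toXY`, with the recursion cut off after `n` steps. -/
def toXYAux : ℕ → WordAlg ℕ →ₗ[ℚ] WordAlg XY
  | 0 => 0
  | n + 1 => eps.smulRight (word []) + cons XY.x ∘ₗ toXYAux n ∘ₗ lower
      + cons XY.y ∘ₗ toXYAux n ∘ₗ dropZero

theorem toXYAux_succ (n : ℕ) (f : WordAlg ℕ) :
    toXYAux (n + 1) f = eps f • word [] + cons XY.x (toXYAux n (lower f))
      + cons XY.y (toXYAux n (dropZero f)) := rfl

/-- Both operators strictly lower the weight, so after `n` steps the recursion has nothing left to
act on. -/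
theorem toXYAux_stable {n m : ℕ} (h : n ≤ m) {f : WordAlg ℕ} (hf : f ∈ weightLT n) :
    toXYAux m f = toXYAux n f := by
  induction n generalizing m f with
  | zero => rw [eq_zero_of_mem_weightLT_zero hf, map_zero, map_zero]
  | succ n ih =>
    obtain ⟨m, rfl⟩ : ∃ k, m = k + 1 := ⟨m - 1, by omega⟩
    rw [toXYAux_succ, toXYAux_succ, ih (by omega) (lower_mem_weightLT hf),
      ih (by omega) (dropZero_mem_weightLT hf)]

/-- The linear map sending the word `d₁ ⋯ d_r` to the coefficient of `∏ Y_i^(d_i) / d_i!` in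
`∑ x^(k₁ - 1) y ⋯ x^(k_r - 1) y (Y₁ + ⋯ + Y_r)^(k₁ - 1) ⋯ (Y₁)^(k_r - 1)`. -/
def toXY : WordAlg ℕ →ₗ[ℚ] WordAlg XY :=
  lift fun w => toXYAux (w.length + w.sum + 1) (word w)

theorem toXY_eq_aux {n : ℕ} {f : WordAlg ℕ} (hf : f ∈ weightLT n) : toXY f = toXYAux n f := by
  induction hf using Submodule.span_induction with
  | mem f hf =>
    obtain ⟨w, hw, rfl⟩ := hf
    rw [toXY, lift_word]
    exact (toXYAux_stable hw (word_mem_weightLT (Nat.lt_succ_self _))).symm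
  | zero => simp
  | add f g _ _ hf hg => simp [hf, hg]
  | smul c f _ hf => simp [hf]

/-- Split the generating series by k₁. If k₁ > 1, an x and a factor Y₁ + ⋯ + Y_r come off, which is
`lower`. If k₁ = 1, a y comes off and the remaining factors do not involve Y_r, so only words with
last letter 0 contribute, which is `dropZero`. -/
theorem toXY_eq (f : WordAlg ℕ) :
    toXY f = eps f • word [] + cons XY.x (toXY (lower f)) + cons XY.y (toXY (dropZero f)) := by
  obtain ⟨n, hn⟩ := exists_mem_weightLT f
  have hn' := weightLT_mono n.le_succ hn
  rw [toXY_eq_aux hn', toXY_eq_aux (lower_mem_weightLT hn'),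
    toXY_eq_aux (dropZero_mem_weightLT hn'), toXYAux_succ]

@[simp] theorem toXY_nil : toXY (word []) = word [] := by
  rw [toXY_eq]; simp

/-- Removing a first x and removing a first y are derivations of the shuffle of words in x and y;
`toXY_eq` matches them with the derivations `lower` and `dropZero`. Constant terms multiply, and
induction on the two weight bounds finishes. -/
theorem toXY_shuffle (f g : WordAlg ℕ) : toXY (shuffle f g) = shuffle (toXY f) (toXY g) := by
  obtain ⟨n, hn⟩ := exists_mem_weightLT f
  obtain ⟨m, hm⟩ := exists_mem_weightLT g
  induction n generalizing f m g with
  | zero => simp [eq_zero_of_mem_weightLT_zero hn]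
  | succ n ihn =>
    induction m generalizing g with
    | zero => simp [eq_zero_of_mem_weightLT_zero hm]
    | succ m ihm =>
      have e1 := ihn _ g (lower_mem_weightLT hn) _ hm
      have e2 := ihn _ g (dropZero_mem_weightLT hn) _ hm
      have e3 := ihm _ (lower_mem_weightLT hm)
      have e4 := ihm _ (dropZero_mem_weightLT hm)
      rw [toXY_eq, lower_shuffle, dropZero_shuffle, eps_shuffle, map_add toXY, map_add toXY,
        e1, e2, e3, e4]
      rw [toXY_eq f, toXY_eq g]
      simp only [map_add, LinearMap.add_apply, map_smul, LinearMap.smul_apply, nil_shuffle,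
        shuffle_nil, shuffle_cons_cons]
      module

/-- The span of the words ending in `y`. -/
def endY : Submodule ℚ (WordAlg XY) := Submodule.span ℚ {f | ∃ u, f = word (u ++ [XY.y])}

theorem cons_mem_endY (a : XY) {f : WordAlg XY} (h : f ∈ endY) : cons a f ∈ endY := by
  suffices endY ≤ endY.comap (cons a) from this h
  refine Submodule.span_le.2 ?_
  rintro _ ⟨u, rfl⟩
  simp only [SetLike.mem_coe, Submodule.mem_comap, cons_word]
  exact Submodule.subset_span ⟨a :: u, rfl⟩

/-- Needed because `decode` forgets a trailing block of x's, so `encode` undoes it only on words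
that are empty or end in y. -/
theorem toXY_sub_eps_mem (f : WordAlg ℕ) : toXY f - eps f • word [] ∈ endY := by
  obtain ⟨n, hn⟩ := exists_mem_weightLT f
  induction n generalizing f with
  | zero => simp [eq_zero_of_mem_weightLT_zero hn]
  | succ n ih =>
    have h1 := ih _ (lower_mem_weightLT hn)
    have h2 := ih _ (dropZero_mem_weightLT hn)
    rw [eps_lower, zero_smul, sub_zero] at h1
    rw [toXY_eq, add_assoc, add_sub_cancel_left]
    refine add_mem (cons_mem_endY _ h1) ?_
    rw [← sub_add_cancel (toXY (dropZero f)) (eps (dropZero f) • word []), map_add, map_smul,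
      cons_word]
    exact add_mem (cons_mem_endY _ h2)
      (Submodule.smul_mem _ _ (Submodule.subset_span ⟨[], rfl⟩))

theorem encode_decode_of_mem_endY {f : WordAlg XY} (hf : f ∈ endY) : encode (decode f) = f := by
  induction hf using Submodule.span_induction with
  | mem f hf =>
    obtain ⟨u, rfl⟩ := hf
    simp [encode, decode, encodeWord_decodeAux, PNat.natPred]
  | zero => simp
  | add f g _ _ hf hg => simp [hf, hg]
  | smul c f _ hf => simp [hf]

theorem encode_nil : encode (word []) = word [] := by simp [encode, encodeWord]

theorem decode_nil : decode (word []) = word [] := by simp [decode, decodeAux]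

/-- The linear map sending the word `d₁ ⋯ d_r` to the coefficient of `∏ Y_i^(d_i) / d_i!` in
`∑ z_{k₁} ⋯ z_{k_r} (Y₁ + ⋯ + Y_r)^(k₁ - 1) ⋯ (Y₁)^(k_r - 1)`. -/
def toH1 : WordAlg ℕ →ₗ[ℚ] H1 := decode ∘ₗ toXY

theorem encode_toH1 (f : WordAlg ℕ) : encode (toH1 f) = toXY f := by
  have h := encode_decode_of_mem_endY (toXY_sub_eps_mem f)
  rw [map_sub, map_sub, map_smul, map_smul, decode_nil, encode_nil] at h
  exact sub_left_injective h

theorem toH1_shuffle (f g : WordAlg ℕ) : toH1 (shuffle f g) = shuffleH1 (toH1 f) (toH1 g) := by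
  rw [shuffleH1, encode_toH1, encode_toH1, ← toXY_shuffle]
  rfl

/-- Raising the first letter of a word by one. -/
def raiseHead : List ℕ+ → List ℕ+
  -- Forced by `decodeAux_succ`: a word consisting of x's alone decodes to the empty word whatever
  -- the starting number.
  | [] => []
  | k :: w => (k + 1) :: w

theorem decodeAux_succ (w : List XY) (n : ℕ+) :
    decodeAux (n + 1) w = raiseHead (decodeAux n w) := by
  induction w generalizing n with
  | nil => rfl
  | cons a w ih =>
    cases a with
    | x => exact ih _
    | y => rfl

/-- Raising the first letter of every word by one. -/
def raise : H1 →ₗ[ℚ] H1 := lift fun w => word (raiseHead w)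

theorem decode_cons_x (f : WordAlg XY) : decode (cons XY.x f) = raise (decode f) := by
  have : decode ∘ₗ cons XY.x = raise ∘ₗ decode := hom_ext fun w => by
    simp [decode, raise, decodeAux, decodeAux_succ]
  exact congrArg (fun F => F f) this

theorem decode_cons_y (f : WordAlg XY) : decode (cons XY.y f) = cons 1 (decode f) := by
  have : decode ∘ₗ cons XY.y = cons 1 ∘ₗ decode := hom_ext fun w => by
    simp [decode, decodeAux]
  exact congrArg (fun F => F f) this

theorem toH1_eq (f : WordAlg ℕ) :
    toH1 f = eps f • word [] + raise (toH1 (lower f)) + cons 1 (toH1 (dropZero f)) := by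
  simp only [toH1, LinearMap.comp_apply]
  rw [toXY_eq]
  simp only [map_add, map_smul, decode_nil, decode_cons_x, decode_cons_y]

@[simp] theorem toH1_nil : toH1 (word []) = word [] := by
  simp [toH1, decode_nil]

theorem raise_decode_mem_H0 {f : WordAlg XY} (hf : f ∈ endY) : raise (decode f) ∈ H0 := by
  suffices endY ≤ H0.comap (raise ∘ₗ decode) from this hf
  refine Submodule.span_le.2 ?_
  rintro _ ⟨u, rfl⟩
  simp only [SetLike.mem_coe, Submodule.mem_comap, LinearMap.comp_apply, decode, raise, lift_word]
  refine Submodule.subset_span ⟨_, ?_, rfl⟩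
  cases decodeAux 1 (u ++ [XY.y]) with
  | nil => simp [raiseHead]
  | cons k w =>
    simp only [raiseHead, List.head?_cons, ne_eq, Option.some.injEq]
    intro h
    have := congrArg PNat.val h
    simp at this

/-- In the recursion only `dropZero` produces words starting with z₁. -/
theorem toH1_mem_H0 {f : WordAlg ℕ} (h : dropZero f = 0) : toH1 f ∈ H0 := by
  rw [toH1_eq, h, map_zero, map_zero, add_zero]
  refine add_mem (Submodule.smul_mem _ _ (Submodule.subset_span ⟨[], by simp, rfl⟩)) ?_
  have h1 := toXY_sub_eps_mem (lower f)
  rw [eps_lower, zero_smul, sub_zero] at h1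
  exact raise_decode_mem_H0 h1

/-! ### Surjectivity -/

/-- The alternating sum of the words `(D^i f) (d + i) / (d + i)!` for `i < n`, where `D` is the
derivation `lower`. -/
def antiLower (n d : ℕ) (f : WordAlg ℕ) : WordAlg ℕ :=
  ∑ i ∈ Finset.range n, ((-1 : ℚ) ^ i / (d + i).factorial) • snoc (d + i) (lower^[i] f)

theorem eps_antiLower (n d : ℕ) (f : WordAlg ℕ) : eps (antiLower n d f) = 0 := by
  simp [antiLower]

theorem dropZero_antiLower (n d : ℕ) (f : WordAlg ℕ) :
    dropZero (antiLower (n + 1) d f) = if d = 0 then f else 0 := by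
  rw [antiLower, map_sum, Finset.sum_range_succ', Finset.sum_eq_zero]
  · rw [map_smul, dropZero_snoc]
    by_cases h : d = 0 <;> simp [h]
  · intro i _
    rw [map_smul, dropZero_snoc, if_neg (by omega), smul_zero]

/-- Telescoping. By `lower_snoc` each summand produces two terms, and the signs and factorials are
chosen so that neighbouring summands cancel, leaving the two ends. -/
theorem lower_antiLower (n d : ℕ) (f : WordAlg ℕ) :
    lower (antiLower (n + 1) d f) = ((d : ℚ) / d.factorial) • snoc (d - 1) f
      + ((-1 : ℚ) ^ n / (d + n).factorial) • snoc (d + n) (lower^[n + 1] f) := by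
  induction n with
  | zero =>
    simp only [antiLower, zero_add, Finset.sum_range_one, map_smul, lower_snoc, Function.iterate_zero,
      id_eq, Function.iterate_one, pow_zero, add_zero, smul_add, smul_smul]
    rw [add_comm]
    congr 2
    ring
  | succ n ih =>
    rw [antiLower, Finset.sum_range_succ, ← antiLower, map_add, ih, map_smul, lower_snoc,
      Function.iterate_succ_apply' _ (n + 1)]
    have h : ((-1 : ℚ) ^ n / (d + n).factorial) =
        - ((-1 : ℚ) ^ (n + 1) / (d + (n + 1)).factorial * ((d + (n + 1) : ℕ) : ℚ)) := by
      have e : (d + (n + 1)).factorial = (d + (n + 1)) * (d + n).factorial :=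
        Nat.factorial_succ (d + n)
      have h1 : ((d + n).factorial : ℚ) ≠ 0 := Nat.cast_ne_zero.2 (Nat.factorial_ne_zero _)
      have h2 : ((d + (n + 1) : ℕ) : ℚ) ≠ 0 := Nat.cast_ne_zero.2 (by omega)
      rw [e, Nat.cast_mul]
      field_simp
      ring
    rw [h, show d + (n + 1) - 1 = d + n by omega]
    module

/-- Local nilpotency of `lower` removes the far end of the telescope. The element `g` has prescribed
images under both derivations, so `toXY g` can be read off from `toXY_eq`. -/
theorem exists_antiLower (d : ℕ) (f : WordAlg ℕ) :
    ∃ g, eps g = 0 ∧ dropZero g = (if d = 0 then f else 0) ∧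
      lower g = ((d : ℚ) / d.factorial) • snoc (d - 1) f := by
  obtain ⟨n, hn⟩ := exists_lower_iterate_eq_zero f
  refine ⟨antiLower (n + 1) d f, eps_antiLower _ _ _, dropZero_antiLower _ _ _, ?_⟩
  rw [lower_antiLower, Function.iterate_succ_apply', hn]
  simp

theorem exists_toXY_cons_y (f : WordAlg ℕ) :
    ∃ g, eps g = 0 ∧ toXY g = cons XY.y (toXY f) := by
  obtain ⟨g, h1, h2, h3⟩ := exists_antiLower 0 f
  refine ⟨g, h1, ?_⟩
  rw [toXY_eq, h1, h2, h3]
  simp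

theorem exists_toXY_cons_x (f : WordAlg ℕ) (hf : eps f = 0) :
    ∃ g, eps g = 0 ∧ dropZero g = 0 ∧ toXY g = cons XY.x (toXY f) := by
  -- The constant term is subtracted to get a statement that is linear in `f` and can be checked on
  -- words. A constant term would ask for the word x, which does not end in y and is not in the
  -- image.
  have key : ∃ g, eps g = 0 ∧ dropZero g = 0 ∧
      toXY g = cons XY.x (toXY (f - eps f • word [])) := by
    clear hf
    induction f using WordAlg.induction_on with
    | hw w =>
      induction w using List.reverseRecOn with
      | nil => exact ⟨0, by simp⟩
      | append_singleton w d _ =>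
        -- At `d + 1` the element `g` is killed by `dropZero`, while `lower g` is `w d` divided by
        -- d!; the factor d! below clears this.
        obtain ⟨g, h1, h2, h3⟩ := exists_antiLower (d + 1) (word w)
        refine ⟨(d.factorial : ℚ) • g, by simp [h1], by simp [h2], ?_⟩
        have h : (d.factorial : ℚ) * (((d + 1 : ℕ) : ℚ) / (d + 1).factorial) = 1 := by
          have h1 : ((d + 1).factorial : ℚ) ≠ 0 := Nat.cast_ne_zero.2 (Nat.factorial_ne_zero _)
          rw [← mul_div_assoc, div_eq_one_iff_eq h1, Nat.factorial_succ, Nat.cast_mul, mul_comm]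
        rw [toXY_eq, map_smul eps, map_smul lower, map_smul dropZero, h1, h2, h3, smul_smul, h,
          ← snoc_word, eps_snoc]
        simp
    | hadd f g hf hg =>
      obtain ⟨a, a1, a2, a3⟩ := hf
      obtain ⟨b, b1, b2, b3⟩ := hg
      refine ⟨a + b, by simp [a1, b1], by simp [a2, b2], ?_⟩
      rw [map_add, a3, b3, ← map_add, ← map_add, map_add eps]
      congr 2
      module
    | hsmul c f hf =>
      obtain ⟨a, a1, a2, a3⟩ := hf
      refine ⟨c • a, by simp [a1], by simp [a2], ?_⟩
      rw [map_smul, a3, ← map_smul, ← map_smul, map_smul eps, smul_sub, smul_assoc]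
  rwa [hf, zero_smul, sub_zero] at key

/-- The encoded word is built from the right: for each letter z_k, first y and then k - 1 times x is
put in front. The outermost letter is x unless k = 1, and `exists_toXY_cons_x` supplies preimages
killed by `dropZero`. -/
theorem exists_toXY_word (w : List ℕ+) :
    ∃ g, toXY g = word (encodeWord w) ∧ (w.head? ≠ some 1 → dropZero g = 0) := by
  induction w with
  | nil => exact ⟨word [], by simp [encodeWord], by simp⟩
  | cons k w ih =>
    obtain ⟨f, hf, -⟩ := ih
    have key : ∀ n : ℕ, ∃ g, eps g = 0 ∧
        toXY g = word (List.replicate n XY.x ++ XY.y :: encodeWord w) ∧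
          (n ≠ 0 → dropZero g = 0) := by
      intro n
      induction n with
      | zero =>
        obtain ⟨g, h1, h2⟩ := exists_toXY_cons_y f
        exact ⟨g, h1, by simp [h2, hf], by simp⟩
      | succ n ih =>
        obtain ⟨g, h1, h2, -⟩ := ih
        obtain ⟨g', h1', h2', h3'⟩ := exists_toXY_cons_x g h1
        exact ⟨g', h1', by simp [h3', h2, List.replicate_succ], fun _ => h2'⟩
    obtain ⟨g, -, h2, h3⟩ := key k.natPred
    refine ⟨g, by simp [h2, encodeWord], fun hk => h3 fun h => hk ?_⟩
    have := PNat.natPred_add_one k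
    rw [List.head?_cons, Option.some.injEq]
    apply PNat.eq
    rw [← this, h]
    rfl

theorem exists_toH1_eq (f : H1) : ∃ g, toH1 g = f := by
  induction f using WordAlg.induction_on with
  | hw w =>
    obtain ⟨g, hg, -⟩ := exists_toXY_word w
    refine ⟨g, ?_⟩
    have h := decode_encode (word w)
    rwa [encode, lift_word, ← hg] at h
  | hadd f g hf hg =>
    obtain ⟨a, rfl⟩ := hf
    obtain ⟨b, rfl⟩ := hg
    exact ⟨a + b, map_add _ _ _⟩
  | hsmul c f hf =>
    obtain ⟨a, rfl⟩ := hf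
    exact ⟨c • a, map_smul _ _ _⟩

theorem exists_toH1_eq_of_mem_H0 {f : H1} (hf : f ∈ H0) : ∃ g, toH1 g = f ∧ dropZero g = 0 := by
  induction hf using Submodule.span_induction with
  | mem f hf =>
    obtain ⟨w, hw, rfl⟩ := hf
    obtain ⟨g, hg, hg'⟩ := exists_toXY_word w
    refine ⟨g, ?_, hg' hw⟩
    have h := decode_encode (word w)
    rwa [encode, lift_word, ← hg] at h
  | zero => exact ⟨0, by simp⟩
  | add f g _ _ hf hg =>
    obtain ⟨a, rfl, ha⟩ := hf
    obtain ⟨b, rfl, hb⟩ := hg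
    exact ⟨a + b, map_add _ _ _, by simp [ha, hb]⟩
  | smul c f _ hf =>
    obtain ⟨a, rfl, ha⟩ := hf
    exact ⟨c • a, map_smul _ _ _, by simp [ha]⟩

open scoped TensorProduct

namespace WordAlg

/-! ### Homomorphisms of stuffle algebras -/

section stuffle

variable {L : Type} [AddCommSemigroup L]

theorem one_eq_word : (1 : WordAlg L) = word [] := rfl

theorem cons_mul_cons (a b : L) (f g : WordAlg L) :
    cons a f * cons b g = cons a (f * cons b g) + cons b (cons a f * g) + cons (a + b) (f * g) :=
  stuffle_cons_cons a b f g

theorem map_mul_of_word {A : Type} [AddCommGroup A] [Module ℚ A] {φ : WordAlg L →ₗ[ℚ] A}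
    {m : A →ₗ[ℚ] A →ₗ[ℚ] A}
    (h : ∀ w v, φ (word w * word v) = m (φ (word w)) (φ (word v))) (f g : WordAlg L) :
    φ (f * g) = m (φ f) (φ g) := by
  have H : (stuffle.compr₂ φ : WordAlg L →ₗ[ℚ] WordAlg L →ₗ[ℚ] A) = m.compl₁₂ φ φ :=
    hom_ext₂ h
  exact congrArg (fun F => F f g) H

/-- A linear map which is multiplicative on words is a homomorphism of algebras. -/
def algHomOfWord {A : Type} [Ring A] [Algebra ℚ A] (φ : WordAlg L →ₗ[ℚ] A)
    (h1 : φ (word []) = 1) (h : ∀ w v, φ (word w * word v) = φ (word w) * φ (word v)) :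
    WordAlg L →ₐ[ℚ] A :=
  AlgHom.ofLinearMap φ h1 (map_mul_of_word (m := LinearMap.mul ℚ A) h)

@[simp] theorem algHomOfWord_apply {A : Type} [Ring A] [Algebra ℚ A] (φ : WordAlg L →ₗ[ℚ] A)
    (h1 : φ (word []) = 1) (h : ∀ w v, φ (word w * word v) = φ (word w) * φ (word v))
    (f : WordAlg L) : algHomOfWord φ h1 h f = φ f := rfl

/-! ### Deconcatenation -/

/-- The deconcatenation coproduct as a linear map. -/
def deconcLin : WordAlg L →ₗ[ℚ] WordAlg L ⊗[ℚ] WordAlg L :=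
  lift (List.rec (word [] ⊗ₜ word []) fun a w t =>
    word [] ⊗ₜ word (a :: w) + (cons a).rTensor (WordAlg L) t)

theorem deconcLin_cons (a : L) (f : WordAlg L) :
    deconcLin (cons a f) = 1 ⊗ₜ cons a f + (cons a).rTensor (WordAlg L) (deconcLin f) := by
  have : (deconcLin ∘ₗ cons a : WordAlg L →ₗ[ℚ] _) =
      TensorProduct.mk ℚ _ _ 1 ∘ₗ cons a + (cons a).rTensor (WordAlg L) ∘ₗ deconcLin :=
    hom_ext fun w => by simp [deconcLin, one_eq_word]
  exact congrArg (fun F => F f) this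

theorem deconcLin_nil : deconcLin (word ([] : List L)) = 1 := by
  simp [deconcLin, Algebra.TensorProduct.one_def, one_eq_word]

theorem rTensor_cons_mul_tmul (a : L) (t : WordAlg L ⊗[ℚ] WordAlg L) (g : WordAlg L) :
    (cons a).rTensor (WordAlg L) t * (1 ⊗ₜ g) = (cons a).rTensor (WordAlg L) (t * (1 ⊗ₜ g)) := by
  induction t with
  | zero => simp
  | tmul f f' => simp
  | add s t hs ht => simp [add_mul, hs, ht]

theorem rTensor_cons_mul_rTensor_cons (a b : L) (s t : WordAlg L ⊗[ℚ] WordAlg L) :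
    (cons a).rTensor (WordAlg L) s * (cons b).rTensor (WordAlg L) t =
      (cons a).rTensor (WordAlg L) (s * (cons b).rTensor (WordAlg L) t) +
      (cons b).rTensor (WordAlg L) ((cons a).rTensor (WordAlg L) s * t) +
      (cons (a + b)).rTensor (WordAlg L) (s * t) := by
  induction s with
  | zero => simp
  | add s s' hs hs' => simp only [map_add, add_mul, hs, hs']; abel
  | tmul f f' =>
    induction t with
    | zero => simp
    | add t t' ht ht' => simp only [map_add, mul_add, ht, ht']; abel
    | tmul g g' => simp [cons_mul_cons, TensorProduct.add_tmul]

/-- The left tensor factor obeys the same three-term recursion as the stuffle itself, apart from the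
terms 1 ⊗ (whole word), which multiply in the right factor. -/
theorem deconcLin_mul (w v : List L) :
    deconcLin (word w * word v) = deconcLin (word w) * deconcLin (word v) := by
  induction w, v using pair_induction with
  | hl v => rw [deconcLin_nil, ← one_eq_word, one_mul, one_mul]
  | hr w => rw [deconcLin_nil, ← one_eq_word, mul_one, mul_one]
  | h a w b v h1 h2 h3 =>
    simp only [← cons_word] at h1 h2 h3 ⊢
    rw [cons_mul_cons]
    simp only [map_add, deconcLin_cons, h1, h2, h3, add_mul, mul_add,
      rTensor_cons_mul_rTensor_cons, rTensor_cons_mul_tmul, Algebra.TensorProduct.tmul_mul_tmul,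
      one_mul, cons_mul_cons, TensorProduct.tmul_add]
    rw [mul_comm (1 ⊗ₜ[ℚ] cons a (word w)) ((cons b).rTensor (WordAlg L) (deconcLin (word v))),
      mul_comm (1 ⊗ₜ[ℚ] cons a (word w)) (deconcLin (word v)), rTensor_cons_mul_tmul]
    abel

/-- The deconcatenation coproduct. -/
def deconc : WordAlg L →ₐ[ℚ] WordAlg L ⊗[ℚ] WordAlg L :=
  algHomOfWord deconcLin deconcLin_nil deconcLin_mul

variable {R : Type} [CommRing R] [Algebra ℚ R]

/-- The convolution product of two characters of the stuffle algebra. -/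
def conv (φ ψ : WordAlg L →ₐ[ℚ] R) : WordAlg L →ₐ[ℚ] R :=
  (Algebra.TensorProduct.lift φ ψ fun _ _ => Commute.all _ _).comp deconc

theorem conv_word (φ ψ : WordAlg L →ₐ[ℚ] R) (w : List L) :
    conv φ ψ (word w) =
      ∑ i ∈ Finset.range (w.length + 1), φ (word (w.take i)) * ψ (word (w.drop i)) := by
  -- Here `φ` is only linear, because the induction replaces it by `φ ∘ₗ cons a`, which is not a
  -- character.
  have key : ∀ (w : List L) (φ : WordAlg L →ₗ[ℚ] R),
      (LinearMap.mul' ℚ R ∘ₗ TensorProduct.map φ ψ.toLinearMap) (deconcLin (word w)) =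
        ∑ i ∈ Finset.range (w.length + 1), φ (word (w.take i)) * ψ (word (w.drop i)) := by
    intro w
    induction w with
    | nil => intro φ; simp [deconcLin]
    | cons a w ih =>
      intro φ
      have h := ih (φ ∘ₗ cons a)
      rw [← cons_word, deconcLin_cons, map_add, List.length_cons, Finset.sum_range_succ', add_comm]
      congr 1
      · rw [← LinearMap.comp_apply, LinearMap.comp_assoc, LinearMap.rTensor,
          ← TensorProduct.map_comp, LinearMap.comp_id, h]
        simp
      · simp [one_eq_word]
  have hlift : (Algebra.TensorProduct.lift φ ψ fun _ _ => Commute.all _ _).toLinearMap =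
      LinearMap.mul' ℚ R ∘ₗ TensorProduct.map φ.toLinearMap ψ.toLinearMap :=
    TensorProduct.ext' fun f g => by simp
  exact (congrArg (fun F => F (deconcLin (word w))) hlift).trans (key w φ.toLinearMap)

end stuffle

end WordAlg

/-! ### Bi-words of the form `[1, …, 1; d₁, …, d_r]` and `[k₁, …, k_r; 0, …, 0]` -/

/-- The projection of `ℚ⟨A⟩` to the span of the words `[1, …, 1; d₁, …, d_r]`, which are read as
the words `d₁ ⋯ d_r`. -/
def onesProj : QA →ₗ[ℚ] WordAlg ℕ :=
  lift (List.rec (word []) fun a _ t => if a.1 = 1 then cons a.2 t else 0)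

/-- The projection of `ℚ⟨A⟩` to the span of the words `[k₁, …, k_r; 0, …, 0]` as a linear map. -/
def zerosProjLin : QA →ₗ[ℚ] H1 :=
  lift (List.rec (word []) fun a _ t => if a.2 = 0 then cons a.1 t else 0)

@[simp] theorem onesProj_nil : onesProj (word []) = word [] := by simp [onesProj]

@[simp] theorem zerosProjLin_nil : zerosProjLin (word []) = word [] := by simp [zerosProjLin]

theorem onesProj_cons (a : BiLetter) (f : QA) :
    onesProj (cons a f) = if a.1 = 1 then cons a.2 (onesProj f) else 0 := by
  have : onesProj ∘ₗ cons a = if a.1 = 1 then cons a.2 ∘ₗ onesProj else 0 :=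
    hom_ext fun w => by by_cases h : a.1 = 1 <;> simp [onesProj, h]
  refine (congrArg (fun F => F f) this).trans ?_
  by_cases h : a.1 = 1 <;> simp [h]

theorem zerosProjLin_cons (a : BiLetter) (f : QA) :
    zerosProjLin (cons a f) = if a.2 = 0 then cons a.1 (zerosProjLin f) else 0 := by
  have : zerosProjLin ∘ₗ cons a = if a.2 = 0 then cons a.1 ∘ₗ zerosProjLin else 0 :=
    hom_ext fun w => by by_cases h : a.2 = 0 <;> simp [zerosProjLin, h]
  refine (congrArg (fun F => F f) this).trans ?_
  by_cases h : a.2 = 0 <;> simp [h]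

theorem pnat_add_ne_one (a b : ℕ+) : a + b ≠ 1 := by
  intro h
  have h' : (a : ℕ) + b = 1 := by rw [← PNat.add_coe, h]; rfl
  have := a.pos
  have := b.pos
  omega

/-- The stuffle product of words `[1, …, 1; d₁, …, d_r]` is the shuffle product up to words in
which other numbers occur in the first row. -/
theorem onesProj_mul (f g : QA) : onesProj (f * g) = shuffle (onesProj f) (onesProj g) := by
  refine map_mul_of_word (m := shuffle) (fun w v => ?_) f g
  induction w, v using pair_induction with
  | hl v => rw [← one_eq_word, one_mul, one_eq_word, onesProj_nil, nil_shuffle]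
  | hr w => rw [← one_eq_word, mul_one, one_eq_word, onesProj_nil, shuffle_nil]
  | h a w b v h1 h2 h3 =>
    simp only [← cons_word] at h1 h2 h3 ⊢
    rw [cons_mul_cons]
    -- A contracted letter has k ≥ 2, so the third stuffle term is projected to zero and the shuffle
    -- recursion remains.
    simp only [map_add, onesProj_cons, h1, h2, Prod.fst_add, pnat_add_ne_one, if_false, add_zero]
    by_cases ha : a.1 = 1 <;> by_cases hb : b.1 = 1 <;> simp [ha, hb, shuffle_cons_cons]

/-- The projection of `ℚ⟨A⟩` to the subalgebra spanned by the words `[k₁, …, k_r; 0, …, 0]`. -/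
def zerosProj : QA →ₐ[ℚ] H1 :=
  algHomOfWord zerosProjLin zerosProjLin_nil fun w v => by
    induction w, v using pair_induction with
    | hl v => rw [← one_eq_word, one_mul, one_eq_word, zerosProjLin_nil, ← one_eq_word, one_mul]
    | hr w => rw [← one_eq_word, mul_one, one_eq_word, zerosProjLin_nil, ← one_eq_word, mul_one]
    | h a w b v h1 h2 h3 =>
      simp only [← cons_word] at h1 h2 h3 ⊢
      rw [cons_mul_cons]
      simp only [map_add, zerosProjLin_cons, h1, h2, h3, Prod.fst_add, Prod.snd_add]
      -- A contracted letter has d = 0 exactly when both letters do, so no stuffle term is lost.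
      by_cases ha : a.2 = 0 <;> by_cases hb : b.2 = 0 <;> simp [ha, hb, cons_mul_cons]

/-- The embedding of `𝔥¹` into `ℚ⟨A⟩` as the span of the words `[k₁, …, k_r; 0, …, 0]`. -/
def zerosIncl : H1 →ₐ[ℚ] QA :=
  algHomOfWord (lift fun k => word (k.map fun i => (i, 0))) (by simp; rfl) fun w v => by
    have hc : ∀ (a : ℕ+) (f : H1), (lift fun k => word (k.map fun i => (i, 0)) : H1 →ₗ[ℚ] QA)
        (cons a f) = cons (a, 0) ((lift fun k => word (k.map fun i => (i, 0)) : H1 →ₗ[ℚ] QA) f) := by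
      intro a f
      have : (lift fun k => word (k.map fun i => (i, 0)) : H1 →ₗ[ℚ] QA) ∘ₗ cons a =
        cons (a, 0) ∘ₗ lift fun k => word (k.map fun i => (i, 0)) := hom_ext fun w => by simp
      exact congrArg (fun F => F f) this
    induction w, v using pair_induction with
    | hl v =>
      rw [← one_eq_word, one_mul]
      simp only [one_eq_word, lift_word, List.map_nil]
      rw [← one_eq_word, one_mul]
    | hr w =>
      rw [← one_eq_word, mul_one]
      simp only [one_eq_word, lift_word, List.map_nil]
      rw [← one_eq_word, mul_one]
    | h a w b v h1 h2 h3 =>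
      simp only [← cons_word] at h1 h2 h3 ⊢
      rw [cons_mul_cons]
      simp only [map_add, hc, cons_mul_cons, h1, h2, h3, Prod.mk_add_mk, add_zero]

@[simp] theorem zerosIncl_word (k : List ℕ+) :
    zerosIncl (word k) = word (k.map fun i => (i, 0)) := by
  simp [zerosIncl]

theorem onesProj_word (w : List BiLetter) :
    onesProj (word w) = if ∀ a ∈ w, a.1 = 1 then word (w.map Prod.snd) else 0 := by
  induction w with
  | nil => simp
  | cons a w ih =>
    rw [← cons_word, onesProj_cons, ih]
    have hc : (∀ b ∈ a :: w, b.1 = 1) ↔ a.1 = 1 ∧ ∀ b ∈ w, b.1 = 1 := List.forall_mem_cons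
    by_cases ha : a.1 = 1
    · by_cases hw : ∀ b ∈ w, b.1 = 1
      · rw [if_pos ha, if_pos hw, if_pos (hc.2 ⟨ha, hw⟩), cons_word, List.map_cons]
      · rw [if_pos ha, if_neg hw, if_neg fun h => hw (hc.1 h).2, map_zero]
    · rw [if_neg ha, if_neg fun h => ha (hc.1 h).1]

theorem zerosProj_word (w : List BiLetter) :
    zerosProj (word w) = if ∀ a ∈ w, a.2 = 0 then word (w.map Prod.fst) else 0 := by
  change zerosProjLin (word w) = _
  induction w with
  | nil => simp
  | cons a w ih =>
    rw [← cons_word, zerosProjLin_cons, ih]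
    have hc : (∀ b ∈ a :: w, b.2 = 0) ↔ a.2 = 0 ∧ ∀ b ∈ w, b.2 = 0 := List.forall_mem_cons
    by_cases ha : a.2 = 0
    · by_cases hw : ∀ b ∈ w, b.2 = 0
      · rw [if_pos ha, if_pos hw, if_pos (hc.2 ⟨ha, hw⟩), cons_word, List.map_cons]
      · rw [if_pos ha, if_neg hw, if_neg fun h => hw (hc.1 h).2, map_zero]
    · rw [if_neg ha, if_neg fun h => ha (hc.1 h).1]

/-! ### Characters of the shuffle algebra from regularization -/

theorem dropZero_zeros (n : ℕ) :
    dropZero (word (List.replicate (n + 1) 0)) = word (List.replicate n 0) := by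
  rw [List.replicate_succ', ← snoc_word, dropZero_snoc, if_pos rfl]

theorem dropZero_iterate_zeros (n : ℕ) :
    dropZero^[n] (word (List.replicate n 0)) = word [] := by
  induction n with
  | zero => rfl
  | succ n ih => rw [Function.iterate_succ_apply, dropZero_zeros, ih]

theorem dropZero_iterate_shuffle (f : WordAlg ℕ) {g : WordAlg ℕ} (hg : dropZero g = 0) (n : ℕ) :
    dropZero^[n] (shuffle f g) = shuffle (dropZero^[n] f) g := by
  induction n generalizing f with
  | zero => rfl
  | succ n ih =>
    rw [Function.iterate_succ_apply, dropZero_shuffle, hg, map_zero, add_zero, ih,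
      Function.iterate_succ_apply]

/-- Every element of the shuffle algebra is a combination of products of a power of the letter `0`
with an element killed by `dropZero`. -/
theorem span_zeros_shuffle (f : WordAlg ℕ) :
    f ∈ Submodule.span ℚ {h | ∃ (n : ℕ) (g : WordAlg ℕ), dropZero g = 0 ∧
      h = shuffle (word (List.replicate n 0)) g} := by
  obtain ⟨n, hn⟩ := exists_dropZero_iterate_eq_zero f
  induction n generalizing f with
  | zero => rw [show f = 0 from hn]; exact zero_mem _
  | succ n ih =>
    have h1 : dropZero (dropZero^[n] f) = 0 := 
      (Function.iterate_succ_apply' dropZero n f).symm.trans hn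
    -- The leading coefficient of `f` as a polynomial in the letter 0 is split off: `dropZero^[n] f`
    -- is a constant for the derivation, which reduces 0ⁿ to the empty word.
    have h2 : dropZero^[n] (f - shuffle (word (List.replicate n 0)) (dropZero^[n] f)) = 0 := by
      rw [iterate_map_sub, dropZero_iterate_shuffle _ h1, dropZero_iterate_zeros, nil_shuffle,
        sub_self]
    rw [← sub_add_cancel f (shuffle (word (List.replicate n 0)) (dropZero^[n] f))]
    exact add_mem (ih _ h2) (Submodule.subset_span ⟨n, _, h1, rfl⟩)

theorem shuffle_zeros (m n : ℕ) : ∃ c : ℚ,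
    shuffle (word (List.replicate m 0)) (word (List.replicate n 0)) =
      c • (word (List.replicate (m + n) 0) : WordAlg ℕ) := by
  induction m generalizing n with
  | zero => exact ⟨1, by simp⟩
  | succ m ihm =>
    induction n with
    | zero => exact ⟨1, by simp⟩
    | succ n ihn =>
      obtain ⟨c, hc⟩ := ihm (n + 1)
      obtain ⟨c', hc'⟩ := ihn
      refine ⟨c + c', ?_⟩
      rw [List.replicate_succ, ← cons_word] at hc' ⊢
      rw [List.replicate_succ (n := n), ← cons_word] at hc ⊢
      rw [shuffle_cons_cons, hc, hc', map_smul, map_smul, cons_word, cons_word, add_smul,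
        ← List.replicate_succ, ← List.replicate_succ]
      congr 4
      omega

section character

variable {R : Type} [CommRing R] [Algebra ℚ R]

/-- The words `0^n` and the elements killed by `dropZero` determine a character of the shuffle
algebra: it suffices to check multiplicativity when one factor is killed by `dropZero`, provided
the words `0^n` with `n > 0` are mapped to zero. -/
theorem map_shuffle_of_dropZero {φ : WordAlg ℕ →ₗ[ℚ] R} (h1 : φ (word []) = 1)
    (h0 : ∀ n, φ (word (List.replicate (n + 1) 0)) = 0)
    (h : ∀ f g, dropZero g = 0 → φ (shuffle f g) = φ f * φ g) (f g : WordAlg ℕ) :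
    φ (shuffle f g) = φ f * φ g := by
  have hz : ∀ m n, φ (shuffle (word (List.replicate m 0)) (word (List.replicate n 0))) =
      φ (word (List.replicate m 0)) * φ (word (List.replicate n 0)) := by
    intro m n
    cases m with
    | zero => simp [h1]
    | succ m =>
      -- The product is a multiple of a nonempty word of zeros, so both sides vanish.
      obtain ⟨c, hc⟩ := shuffle_zeros (m + 1) n
      rw [hc, map_smul, show m + 1 + n = m + n + 1 by omega, h0, h0, smul_zero, zero_mul]
  have hn : ∀ n, φ (shuffle f (word (List.replicate n 0))) =
      φ f * φ (word (List.replicate n 0)) := by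
    intro n
    have hf := span_zeros_shuffle f
    induction hf using Submodule.span_induction with
    | mem f hf =>
      obtain ⟨m, c, hc, rfl⟩ := hf
      rw [shuffle_comm, ← shuffle_assoc, h _ _ hc, h _ _ hc, shuffle_comm, hz]
      ring
    | zero => simp
    | add f g _ _ hf hg => simp [hf, hg, add_mul]
    | smul c f _ hf => simp [hf]
  have hg := span_zeros_shuffle g
  induction hg using Submodule.span_induction with
  | mem g hg =>
    obtain ⟨m, c, hc, rfl⟩ := hg
    rw [← shuffle_assoc, h _ _ hc, h _ _ hc, hn, mul_assoc]
  | zero => simp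
  | add f g _ _ hf hg => simp [hf, hg, mul_add]
  | smul c f _ hf => simp [hf]

theorem dropZero_iterate_word (w : List ℕ) (j : ℕ) :
    dropZero^[j] (word w) =
      if j ≤ w.length ∧ ∀ a ∈ w.drop (w.length - j), a = 0 then word (w.take (w.length - j))
      else 0 := by
  induction w using List.reverseRecOn generalizing j with
  | nil =>
    cases j with
    | zero => simp
    | succ j => rw [Function.iterate_succ_apply, dropZero_nil, iterate_map_zero]; simp
  | append_singleton w d ih =>
    cases j with
    | zero => simp [List.take_of_length_le]
    | succ j =>
      rw [Function.iterate_succ_apply, ← snoc_word, dropZero_snoc]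
      have e : (w ++ [d]).length - (j + 1) = w.length - j := by simp
      rw [e, List.take_append_of_le_length (by omega), List.drop_append_of_le_length (by omega)]
      by_cases hd : d = 0
      · rw [if_pos hd, ih]
        simp [hd, or_imp]
      · rw [if_neg hd, iterate_map_zero, if_neg]
        simp [hd]

/-- The combination `∑ h_j φ(∂^j f)`, where `∂` deletes a last letter `0` and `h_j` are scalars. -/
def twist (φ : WordAlg ℕ →ₗ[ℚ] R) (h : ℕ → R) : WordAlg ℕ →ₗ[ℚ] R :=
  lift fun w => ∑ j ∈ Finset.range (w.length + 1), h j * φ (dropZero^[j] (word w))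

theorem twist_word (φ : WordAlg ℕ →ₗ[ℚ] R) (h : ℕ → R) (w : List ℕ) :
    twist φ h (word w) = ∑ i ∈ Finset.range (w.length + 1),
      φ (word (w.take i)) * (if ∀ a ∈ w.drop i, a = 0 then h (w.length - i) else 0) := by
  rw [twist, lift_word, ← Finset.sum_range_reflect]
  refine Finset.sum_congr rfl fun i hi => ?_
  have hi' : i ≤ w.length := by have := Finset.mem_range.1 hi; omega
  have e : w.length - (w.length + 1 - 1 - i) = i := by omega
  rw [dropZero_iterate_word, e]
  have e' : w.length + 1 - 1 - i = w.length - i := by omega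
  rw [e']
  by_cases hw : ∀ a ∈ w.drop i, a = 0
  · rw [if_pos ⟨by omega, hw⟩, if_pos hw, mul_comm]
  · rw [if_neg fun H => hw H.2, if_neg hw]
    simp

/-- The sum defining `twist` may be cut off anywhere beyond the nilpotency order. -/
theorem twist_eq (φ : WordAlg ℕ →ₗ[ℚ] R) (h : ℕ → R) (f : WordAlg ℕ) :
    ∃ N, ∀ n, N ≤ n → twist φ h f = ∑ j ∈ Finset.range n, h j * φ (dropZero^[j] f) := by
  induction f using WordAlg.induction_on with
  | hw w =>
    refine ⟨w.length + 1, fun n hn => ?_⟩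
    rw [twist, lift_word]
    refine Finset.sum_subset (Finset.range_mono hn) fun j _ hj => ?_
    rw [dropZero_iterate_word, if_neg, map_zero, mul_zero]
    rintro ⟨h, -⟩
    exact hj (Finset.mem_range.2 (by omega))
  | hadd f g hf hg =>
    obtain ⟨N, hN⟩ := hf
    obtain ⟨M, hM⟩ := hg
    refine ⟨max N M, fun n hn => ?_⟩
    rw [map_add, hN n (by omega), hM n (by omega), ← Finset.sum_add_distrib]
    refine Finset.sum_congr rfl fun j _ => ?_
    rw [iterate_map_add, map_add, mul_add]
  | hsmul c f hf =>
    obtain ⟨N, hN⟩ := hf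
    refine ⟨N, fun n hn => ?_⟩
    rw [map_smul, hN n hn, Finset.smul_sum]
    refine Finset.sum_congr rfl fun j _ => ?_
    simp only [← Module.End.pow_apply, map_smul, mul_smul_comm]

/-- A factor killed by the derivation passes through all its iterates, so each summand of the twist
is multiplicative in this sense. On that factor alone, only the summand j = 0 survives. -/
theorem twist_shuffle_of_dropZero {φ : WordAlg ℕ →ₗ[ℚ] R} (h : ℕ → R) (hh : h 0 = 1)
    (hφ : ∀ f g, dropZero g = 0 → φ (shuffle f g) = φ f * φ g) (f g : WordAlg ℕ)
    (hg : dropZero g = 0) : twist φ h (shuffle f g) = twist φ h f * twist φ h g := by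
  obtain ⟨N, hN⟩ := twist_eq φ h f
  obtain ⟨M, hM⟩ := twist_eq φ h g
  obtain ⟨K, hK⟩ := twist_eq φ h (shuffle f g)
  have hgφ : twist φ h g = φ g := by
    rw [hM (M + 1) (by omega), Finset.sum_range_succ', Finset.sum_eq_zero, zero_add, hh]
    · simp
    · intro i _
      rw [Function.iterate_succ_apply, hg, iterate_map_zero, map_zero, mul_zero]
  rw [hgφ, hN (max N K) (by omega), hK (max N K) (by omega), Finset.sum_mul]
  refine Finset.sum_congr rfl fun j _ => ?_
  rw [dropZero_iterate_shuffle _ hg, hφ _ _ hg, mul_assoc]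

theorem twist_zeros (φ : WordAlg ℕ →ₗ[ℚ] R) (h : ℕ → R) (n : ℕ) :
    twist φ h (word (List.replicate n 0)) =
      ∑ i ∈ Finset.range (n + 1), φ (word (List.replicate i 0)) * h (n - i) := by
  rw [twist_word, List.length_replicate]
  refine Finset.sum_congr rfl fun i hi => ?_
  have hi' : i ≤ n := by have := Finset.mem_range.1 hi; omega
  rw [if_pos (fun a ha => List.eq_of_mem_replicate (List.mem_of_mem_drop ha)), List.take_replicate,
    min_eq_left hi']

/-- A functional which is multiplicative when one factor is killed by `dropZero` can be twisted to a
character, by the inverse of the generating series of its values on the words `0^n`. -/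
theorem exists_twist_shuffle (φ : WordAlg ℕ →ₗ[ℚ] R) (h1 : φ (word []) = 1)
    (hφ : ∀ f g, dropZero g = 0 → φ (shuffle f g) = φ f * φ g) :
    ∃ h : ℕ → R, twist φ h (word []) = 1 ∧
      (∀ n, twist φ h (word (List.replicate (n + 1) 0)) = 0) ∧
      ∀ f g, twist φ h (shuffle f g) = twist φ h f * twist φ h g := by
  let g : PowerSeries R := PowerSeries.mk fun n => φ (word (List.replicate n 0))
  -- On the words 0ⁿ, twisting multiplies the generating series `g` by that of `h`. Taking the
  -- inverse series makes the result 1, so all values with n > 0 vanish.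
  let k : PowerSeries R := PowerSeries.invOfUnit g 1
  have hgk : g * k = 1 := PowerSeries.mul_invOfUnit g 1 (by simp [g, h1])
  have hz : ∀ n, twist φ (fun j => PowerSeries.coeff j k) (word (List.replicate n 0)) =
      PowerSeries.coeff n (1 : PowerSeries R) := by
    intro n
    rw [twist_zeros, ← hgk, PowerSeries.coeff_mul,
      Finset.Nat.sum_antidiagonal_eq_sum_range_succ_mk]
    simp [g]
  have hk : PowerSeries.coeff 0 k = 1 := by simp [k]
  have hn : twist φ (fun j => PowerSeries.coeff j k) (word []) = 1 := by simpa using hz 0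
  have h0 : ∀ n, twist φ (fun j => PowerSeries.coeff j k) (word (List.replicate (n + 1) 0)) = 0 :=
    fun n => by rw [hz, PowerSeries.coeff_one, if_neg (by omega)]
  exact ⟨fun j => PowerSeries.coeff j k, hn, h0,
    map_shuffle_of_dropZero hn h0 (twist_shuffle_of_dropZero _ hk hφ)⟩

end character

/-! ### Words without the special shape -/

/-- The bi-word `[1, …, 1; d₁, …, d_r]`. -/
def ones (d : List ℕ) : List BiLetter := d.map fun i => (1, i)

/-- The bi-word `[k₁, …, k_r; 0, …, 0]`. -/
def zeros (k : List ℕ+) : List BiLetter := k.map fun i => (i, 0)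

@[simp] theorem ones_nil : ones [] = [] := rfl

@[simp] theorem ones_cons (a : ℕ) (d : List ℕ) : ones (a :: d) = (1, a) :: ones d := rfl

@[simp] theorem ones_append (d e : List ℕ) : ones (d ++ e) = ones d ++ ones e :=
  List.map_append

@[simp] theorem zeros_nil : zeros [] = [] := rfl

@[simp] theorem zeros_cons (a : ℕ+) (k : List ℕ+) : zeros (a :: k) = (a, 0) :: zeros k := rfl

/-- In any admissible splitting the letter `c` must belong to the second part, and then so do all
letters after it, which forces d = 0 from `c` on. -/
theorem not_isSpecial {p q : List BiLetter} {c : BiLetter} (hc : c.1 ≠ 1)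
    (h : ∃ a ∈ c :: q, 0 < a.2) : ¬ IsSpecial (p ++ c :: q) := by
  rintro ⟨u, v, huv, hu, hv⟩
  obtain ⟨a, ha, ha0⟩ := h
  rcases List.append_eq_append_iff.1 huv with ⟨t, h1, h2⟩ | ⟨t, h1, h2⟩
  · cases t with
    | nil =>
      rw [List.nil_append] at h2
      rw [hv a (h2 ▸ ha)] at ha0
      omega
    | cons b t =>
      rw [List.cons_append, List.cons.injEq] at h2
      exact hc (h2.1 ▸ hu b (by simp [h1]))
  · rw [hv a (by rw [h2]; exact List.mem_append_right _ ha)] at ha0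
    omega

/-- The stuffle product of words, one of which has a letter with a property inherited by sums, is a
combination of words with this property. -/
theorem word_mul_word_mem_span {L : Type} [AddCommSemigroup L] {p : L → Prop}
    (hp : ∀ a b, p a → p (a + b)) (w v : List L) (h : ∃ a ∈ w ++ v, p a) :
    word w * word v ∈ Submodule.span ℚ {f | ∃ u : List L, (∃ a ∈ u, p a) ∧ f = word u} := by
  have hcons : ∀ (a : L) (f : WordAlg L),
      (p a ∨ f ∈ Submodule.span ℚ {f | ∃ u : List L, (∃ a ∈ u, p a) ∧ f = word u}) →
      cons a f ∈ Submodule.span ℚ {f | ∃ u : List L, (∃ a ∈ u, p a) ∧ f = word u} := by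
    rintro a f (ha | hf)
    · induction f using WordAlg.induction_on with
      | hw u => exact Submodule.subset_span ⟨a :: u, ⟨a, by simp, ha⟩, by simp⟩
      | hadd f g hf hg => rw [map_add]; exact add_mem hf hg
      | hsmul c f hf => rw [map_smul]; exact Submodule.smul_mem _ _ hf
    · induction hf using Submodule.span_induction with
      | mem f hf =>
        obtain ⟨u, ⟨b, hb, hb'⟩, rfl⟩ := hf
        exact Submodule.subset_span ⟨a :: u, ⟨b, by simp [hb], hb'⟩, by simp⟩
      | zero => simp
      | add f g _ _ hf hg => rw [map_add]; exact add_mem hf hg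
      | smul c f _ hf => rw [map_smul]; exact Submodule.smul_mem _ c hf
  induction w, v using pair_induction with
  | hl v =>
    rw [← one_eq_word, one_mul]
    exact Submodule.subset_span ⟨v, by simpa using h, rfl⟩
  | hr w =>
    rw [← one_eq_word, mul_one]
    exact Submodule.subset_span ⟨w, by simpa using h, rfl⟩
  | h a w b v h1 h2 h3 =>
    simp only [List.cons_append, List.mem_cons, List.mem_append, or_and_right,
      exists_or, exists_eq_left] at h h1 h2 h3
    simp only [← cons_word] at h1 h2 h3 ⊢
    rw [cons_mul_cons]
    refine add_mem (add_mem (hcons _ _ ?_) (hcons _ _ ?_)) (hcons _ _ ?_)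
    · by_cases ha : p a
      · exact Or.inl ha
      · exact Or.inr (h1 (h.resolve_left ha))
    · by_cases hb : p b
      · exact Or.inl hb
      · refine Or.inr (h2 ?_)
        rcases h with h | h | h | h
        exacts [Or.inl h, Or.inr (Or.inl h), absurd h hb, Or.inr (Or.inr h)]
    · by_cases hab : p a ∨ p b
      · refine Or.inl (hab.elim (hp a b) fun hb => ?_)
        rw [add_comm]
        exact hp b a hb
      · refine Or.inr (h3 ?_)
        rcases h with h | h | h | h
        exacts [absurd (Or.inl h) hab, Or.inl h, absurd (Or.inr h) hab, Or.inr h]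

/-- Prepending the word `p` to every word. -/
def prepend (p : List BiLetter) : QA →ₗ[ℚ] QA := lift fun w => word (p ++ w)

@[simp] theorem prepend_word (p w : List BiLetter) : prepend p (word w) = word (p ++ w) := by
  simp [prepend]

theorem prepend_cons (p : List BiLetter) (a : BiLetter) (f : QA) :
    prepend p (cons a f) = prepend (p ++ [a]) f := by
  have : prepend p ∘ₗ cons a = prepend (p ++ [a]) := hom_ext fun w => by simp
  exact congrArg (fun F => F f) this

theorem prepend_nil (f : QA) : prepend [] f = f := by
  have : prepend [] = LinearMap.id := hom_ext fun w => by simp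
  exact congrArg (fun F => F f) this

/-- The embedding of the words `d₁ ⋯ d_r` into `ℚ⟨A⟩` as words `[1, …, 1; d₁, …, d_r]`. -/
def onesIncl : WordAlg ℕ →ₗ[ℚ] QA := lift fun d => word (ones d)

@[simp] theorem onesIncl_word (d : List ℕ) : onesIncl (word d) = word (ones d) := by
  simp [onesIncl]

theorem onesIncl_cons (a : ℕ) (f : WordAlg ℕ) : onesIncl (cons a f) = cons (1, a) (onesIncl f) := by
  have : onesIncl ∘ₗ cons a = cons (1, a) ∘ₗ onesIncl := hom_ext fun w => by simp
  exact congrArg (fun F => F f) this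

theorem mem_span_of_dropZero_eq_zero {f : WordAlg ℕ} (h : dropZero f = 0) :
    f ∈ Submodule.span ℚ {g | ∃ v : List ℕ, v.getLast? ≠ some 0 ∧ g = word v} := by
  have key : f - snoc 0 (dropZero f) ∈
      Submodule.span ℚ {g | ∃ v : List ℕ, v.getLast? ≠ some 0 ∧ g = word v} := by
    clear h
    induction f using WordAlg.induction_on with
    | hw w =>
      induction w using List.reverseRecOn with
      | nil => exact Submodule.subset_span ⟨[], by simp⟩
      | append_singleton w d _ =>
        by_cases hd : d = 0
        · rw [← snoc_word, dropZero_snoc, if_pos hd, hd, sub_self]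
          exact zero_mem _
        · rw [← snoc_word, dropZero_snoc, if_neg hd, map_zero, sub_zero, snoc_word]
          exact Submodule.subset_span ⟨w ++ [d], by simp [hd], rfl⟩
    | hadd f g hf hg =>
      rw [map_add, map_add, add_sub_add_comm]
      exact add_mem hf hg
    | hsmul c f hf =>
      rw [map_smul, map_smul, ← smul_sub]
      exact Submodule.smul_mem _ _ hf
  rwa [h, map_zero, sub_zero] at key

theorem exists_pos_of_getLast? {d : List ℕ} (h : d.getLast? ≠ some 0) (hd : d ≠ []) :
    ∃ a ∈ d, 0 < a :=
  ⟨d.getLast hd, List.getLast_mem hd, Nat.pos_of_ne_zero fun h0 =>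
    h (by rw [List.getLast?_eq_some_getLast hd, h0])⟩

/-! ### Characters that vanish on the non-special words -/

section vanishing

variable {R : Type} [CommRing R] [Algebra ℚ R] {G : QA →ₐ[ℚ] R}

/-- A positive d cannot disappear in a stuffle product, since merging letters adds the entries d. So
every word that occurs has the letter `c` with k ≠ 1 and a positive d at or after it. -/
theorem map_prepend_cons_eq_zero (hG : ∀ w, ¬ IsSpecial w → G (word w) = 0) (p : List BiLetter)
    {c : BiLetter} (hc : c.1 ≠ 1) (w v : List BiLetter) (h : ∃ a ∈ c :: (w ++ v), 0 < a.2) :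
    G (prepend p (cons c (word w * word v))) = 0 := by
  by_cases hc0 : 0 < c.2
  · generalize word w * word v = f
    induction f using WordAlg.induction_on with
    | hw u =>
      rw [cons_word, prepend_word]
      exact hG _ (not_isSpecial hc ⟨c, by simp, hc0⟩)
    | hadd f g hf hg => simp [hf, hg]
    | hsmul a f hf => simp [hf]
  · have h' : ∃ a ∈ w ++ v, 0 < a.2 := by
      obtain ⟨a, ha, ha0⟩ := h
      rcases List.mem_cons.1 ha with rfl | ha
      · exact absurd ha0 hc0
      · exact ⟨a, ha, ha0⟩
    have hm := word_mul_word_mem_span (p := fun a : BiLetter => 0 < a.2)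
      (fun a b hab => by simpa using Or.inl hab) w v h'
    generalize word w * word v = f at hm
    induction hm using Submodule.span_induction with
    | mem f hf =>
      obtain ⟨u, ⟨a, ha, ha0⟩, rfl⟩ := hf
      rw [cons_word, prepend_word]
      exact hG _ (not_isSpecial hc ⟨a, by simp [ha], ha0⟩)
    | zero => simp
    | add f g _ _ hf hg => simp [hf, hg]
    | smul a f _ hf => simp [hf]

/-- The stuffle differs from the shuffle by contracted terms, each containing a letter with k = 2.
The condition on `v` provides a positive d at or after that letter, so these terms are non-special.
Without it the special word [2;0] could appear. The prefix `p` is what makes the induction on first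
letters run. -/
theorem map_prepend_ones_mul_ones (hG : ∀ w, ¬ IsSpecial w → G (word w) = 0)
    (u v : List ℕ) (hv : v.getLast? ≠ some 0) (p : List BiLetter) :
    G (prepend p (word (ones u) * word (ones v))) =
      G (prepend p (onesIncl (shuffle (word u) (word v)))) := by
  induction u, v using pair_induction generalizing p with
  | hl v => rw [ones_nil, ← one_eq_word, one_mul, nil_shuffle, onesIncl_word]
  | hr w => rw [ones_nil, ← one_eq_word, mul_one, shuffle_nil, onesIncl_word]
  | h a u b v h1 h2 _ =>
    have hv' : v.getLast? ≠ some 0 := by cases v <;> simp_all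
    have h3 : G (prepend p (cons ((1, a) + (1, b)) (word (ones u) * word (ones v)))) = 0 := by
      refine map_prepend_cons_eq_zero hG p (pnat_add_ne_one 1 1) _ _ ?_
      -- The positive last letter of the second word is either the contracted `b` itself or still
      -- ahead in `v`.
      by_cases hv0 : v = []
      · refine ⟨_, List.mem_cons_self, ?_⟩
        have : b ≠ 0 := by simpa [hv0] using hv
        simp only [Prod.snd_add]
        omega
      · obtain ⟨c, hc, hc0⟩ := exists_pos_of_getLast? hv' hv0
        exact ⟨(1, c), by simp [ones, hc], hc0⟩
    have e1 := h1 hv (p ++ [(1, a)])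
    have e2 := h2 hv' (p ++ [(1, b)])
    rw [ones_cons, ← cons_word] at e2 ⊢
    rw [ones_cons, ← cons_word] at e1 ⊢
    rw [prepend_cons] at h3
    rw [cons_mul_cons]
    simp only [map_add, h3, prepend_cons, e1, e2, add_zero]
    rw [← cons_word (a := a) (w := u), ← cons_word (a := b) (w := v), shuffle_cons_cons]
    simp only [map_add, onesIncl_cons, prepend_cons]

theorem map_onesIncl_mul (hG : ∀ w, ¬ IsSpecial w → G (word w) = 0) (f : WordAlg ℕ)
    {g : WordAlg ℕ} (hg : dropZero g = 0) :
    G (onesIncl f) * G (onesIncl g) = G (onesIncl (shuffle f g)) := by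
  have hg' := mem_span_of_dropZero_eq_zero hg
  clear hg
  induction hg' using Submodule.span_induction with
  | mem g hg =>
    obtain ⟨v, hv, rfl⟩ := hg
    induction f using WordAlg.induction_on with
    | hw u =>
      have h := map_prepend_ones_mul_ones hG u v hv []
      rwa [prepend_nil, prepend_nil, map_mul, ← onesIncl_word, ← onesIncl_word] at h
    | hadd f g hf hg => simp only [map_add, add_mul, LinearMap.add_apply, hf, hg]
    | hsmul c f hf => simp only [map_smul, smul_mul_assoc, LinearMap.smul_apply, hf]
  | zero => simp
  | add f g _ _ hf hg => simp only [map_add, mul_add, hf, hg]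
  | smul c f _ hf => simp only [map_smul, mul_smul_comm, hf]

/-- The extended double shuffle relations hold for the images of the words `[k; 0]`. -/
theorem map_zerosIncl_eds (hG : ∀ w, ¬ IsSpecial w → G (word w) = 0)
    (hP : ∀ d : List ℕ, G (word (ones d)) = G (zerosIncl (toH1 (word d)))) (f : H1) {g : H1}
    (hg : g ∈ H0) : G (zerosIncl (f * g - shuffleH1 f g)) = 0 := by
  have hP' : ∀ a, G (onesIncl a) = G (zerosIncl (toH1 a)) := by
    intro a
    induction a using WordAlg.induction_on with
    | hw d => rw [onesIncl_word, hP]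
    | hadd f g hf hg => simp only [map_add, hf, hg]
    | hsmul c f hf => simp only [map_smul, hf]
  obtain ⟨a, rfl⟩ := exists_toH1_eq f
  obtain ⟨b, rfl, hb⟩ := exists_toH1_eq_of_mem_H0 hg
  -- Both products are transported to words [1,…,1;d], where the stuffle and the shuffle agree under
  -- `G`.
  rw [map_sub, map_sub, map_mul, map_mul, ← toH1_shuffle, ← hP', ← hP', ← hP',
    map_onesIncl_mul hG a hb, sub_self]

/-- In the stuffle of `ones d` and `zeros q`, the concatenation `ones d ++ zeros q` occurs. As `d`
ends in a positive letter, a contraction, or a letter [k;0] with k ≠ 1 placed before that end, gives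
a non-special word. What remains has letters [1;0] moved forward and involves a shorter `q`. Hence
the simultaneous induction on `q`: the second claim, on differences, yields the first by taking an
empty prefix. -/
theorem map_ones_append_zeros_mem (hG : ∀ w, ¬ IsSpecial w → G (word w) = 0)
    (hP : ∀ d : List ℕ, G (word (ones d)) = G (zerosIncl (toH1 (word d)))) (q : List ℕ+) :
    (∀ d : List ℕ, d ≠ [] → d.getLast? ≠ some 0 →
      G (word (ones d ++ zeros q)) ∈ (G.comp zerosIncl).range) ∧
    ∀ d : List ℕ, d ≠ [] → d.getLast? ≠ some 0 → ∀ p : List ℕ,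
      G (prepend (ones p) (word (ones d) * word (zeros q))) - G (word (ones (p ++ d) ++ zeros q)) ∈
        (G.comp zerosIncl).range := by
  have hones : ∀ d : List ℕ, G (word (ones d)) ∈ (G.comp zerosIncl).range :=
    fun d => ⟨toH1 (word d), (hP d).symm⟩
  induction q with
  | nil =>
    refine ⟨fun d _ _ => ?_, fun d _ _ p => ?_⟩
    · rw [zeros_nil, List.append_nil]
      exact hones d
    · rw [zeros_nil, ← one_eq_word, mul_one, prepend_word, List.append_nil, ones_append, sub_self]
      exact zero_mem _
  | cons k q ih =>
    obtain ⟨ihM, ihC⟩ := ih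
    have hC : ∀ d : List ℕ, d ≠ [] → d.getLast? ≠ some 0 → ∀ p : List ℕ,
        G (prepend (ones p) (word (ones d) * word (zeros (k :: q)))) -
          G (word (ones (p ++ d) ++ zeros (k :: q))) ∈ (G.comp zerosIncl).range := by
      intro d
      induction d with
      | nil => exact fun h => absurd rfl h
      | cons a d ihd =>
        intro _ hd p
        obtain ⟨c, hc, hc0⟩ := exists_pos_of_getLast? hd (by simp)
        have hpos : ∃ b ∈ ones (a :: d) ++ zeros q, 0 < b.2 :=
          ⟨(1, c), List.mem_append_left _ (List.mem_map.2 ⟨c, hc, rfl⟩), hc0⟩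
        have h3 : G (prepend (ones p) (cons ((1, a) + (k, 0)) (word (ones d) * word (zeros q)))) =
            0 := by
          refine map_prepend_cons_eq_zero hG _ (pnat_add_ne_one 1 k) _ _ ?_
          rcases List.mem_cons.1 hc with rfl | hc
          · exact ⟨_, List.mem_cons_self, by simpa using hc0⟩
          · exact ⟨(1, c), by simp [ones, hc], hc0⟩
        have h2 : G (prepend (ones p) (cons (k, 0) (word (ones (a :: d)) * word (zeros q)))) ∈
            (G.comp zerosIncl).range := by
          -- A letter [1;0] may join the prefix of ones, which reduces to the shorter `q`; any other
          -- letter [k;0] before a positive d gives zero.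
          by_cases hk : k = 1
          · have h := add_mem (ihC (a :: d) (by simp) hd (p ++ [0]))
              (ihM (p ++ [0] ++ a :: d) (by simp) (by simpa using hd))
            rw [sub_add_cancel] at h
            rw [prepend_cons, hk]
            simpa using h
          · rw [map_prepend_cons_eq_zero hG _ hk _ _]
            · exact zero_mem _
            · obtain ⟨b, hb, hb0⟩ := hpos
              exact ⟨b, List.mem_cons_of_mem _ hb, hb0⟩
        have h1 : G (prepend (ones p) (cons (1, a) (word (ones d) * word (zeros (k :: q))))) -
            G (word (ones (p ++ a :: d) ++ zeros (k :: q))) ∈ (G.comp zerosIncl).range := by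
          -- With `d` exhausted, the product is exactly the concatenation and the difference is
          -- zero.
          by_cases hd0 : d = []
          · rw [hd0, ones_nil, ← one_eq_word, one_mul, cons_word, prepend_word, ones_append]
            simp
          · have h := ihd hd0 (by cases d <;> simp_all) (p ++ [a])
            rw [prepend_cons]
            simpa using h
        have e : word (ones (a :: d)) * word (zeros (k :: q)) =
            cons (1, a) (word (ones d) * word (zeros (k :: q))) +
              cons (k, 0) (word (ones (a :: d)) * word (zeros q)) +
              cons ((1, a) + (k, 0)) (word (ones d) * word (zeros q)) := by
          rw [ones_cons, zeros_cons, ← cons_word, ← cons_word, cons_mul_cons]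
        rw [e]
        simp only [map_add, h3, add_zero]
        rw [add_sub_right_comm]
        exact add_mem h1 h2
    refine ⟨fun d hd hd' => ?_, hC⟩
    have h := hC d hd hd' []
    rw [ones_nil, prepend_nil, List.nil_append, map_mul] at h
    -- With an empty prefix the stuffle becomes a product of two elements of the subalgebra.
    have h' := mul_mem (hones d) (show G (word (zeros (k :: q))) ∈ (G.comp zerosIncl).range from
      ⟨word (k :: q), by simp [zeros]⟩)
    simpa using sub_mem h' h

/-- Modulo the words without the special shape, everything is a combination of the words
`[k; 0]`. -/
theorem map_mem_range_zerosIncl (hG : ∀ w, ¬ IsSpecial w → G (word w) = 0)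
    (hP : ∀ d : List ℕ, G (word (ones d)) = G (zerosIncl (toH1 (word d)))) (f : QA) :
    G f ∈ (G.comp zerosIncl).range := by
  induction f using WordAlg.induction_on with
  | hw w =>
    by_cases hw : IsSpecial w
    · obtain ⟨u, v, rfl, hu, hv⟩ := hw
      obtain ⟨d, rfl⟩ : ∃ d, u = ones d := by
        refine ⟨u.map Prod.snd, ?_⟩
        rw [ones, List.map_map]
        conv_lhs => rw [← List.map_id u]
        exact List.map_congr_left fun a ha => Prod.ext (hu a ha) rfl
      obtain ⟨k, rfl⟩ : ∃ k, v = zeros k := by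
        refine ⟨v.map Prod.fst, ?_⟩
        rw [zeros, List.map_map]
        conv_lhs => rw [← List.map_id v]
        exact List.map_congr_left fun a ha => Prod.ext rfl (hv a ha)
      clear hu hv
      induction d using List.reverseRecOn generalizing k with
      | nil => exact ⟨word k, by simp [zeros]⟩
      | append_singleton d a ih =>
        -- A letter [1;0] belongs to both halves of the special shape, so trailing zeros of `d` are
        -- moved into `k` as letters 1.
        by_cases ha : a = 0
        · have h := ih (1 :: k)
          rw [ones_append, List.append_assoc, ha]
          exact h
        · exact (map_ones_append_zeros_mem hG hP k).1 _ (by simp) (by simp [ha])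
    · rw [hG w hw]
      exact zero_mem _
  | hadd f g hf hg => rw [map_add]; exact add_mem hf hg
  | hsmul c f hf => rw [map_smul]; exact Subalgebra.smul_mem _ hf c

end vanishing

/-! ### Coefficients of power series after renaming variables -/

section powerSeries

open MvPowerSeries

variable {σ τ ρ : Type} {R : Type} [CommRing R]

theorem coeff_X_mul [DecidableEq σ] (s : σ) (f : MvPowerSeries σ R) (e : σ →₀ ℕ) :
    coeff e (X s * f) = if e s = 0 then 0 else coeff (e - Finsupp.single s 1) f := by
  rw [X, coeff_monomial_mul, one_mul]
  by_cases h : e s = 0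
  · rw [if_pos h, if_neg (by rw [Finsupp.single_le_iff]; omega)]
  · rw [if_neg h, if_pos (by rw [Finsupp.single_le_iff]; omega)]

/-- The exponent vector pulled back along an injection. -/
def pullExp (ι : σ ↪ τ) (e : τ →₀ ℕ) : σ →₀ ℕ := e.comapDomain ι ι.injective.injOn

@[simp] theorem pullExp_apply (ι : σ ↪ τ) (e : τ →₀ ℕ) (s : σ) : pullExp ι e s = e (ι s) := rfl

theorem embDomain_pullExp (ι : σ ↪ τ) {e : τ →₀ ℕ} (h : ∀ t ∉ Set.range ι, e t = 0) :
    Finsupp.embDomain ι (pullExp ι e) = e := by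
  ext t
  by_cases ht : t ∈ Set.range ι
  · obtain ⟨s, rfl⟩ := ht
    rw [Finsupp.embDomain_apply_self, pullExp_apply]
  · rw [Finsupp.embDomain_of_notMem_range _ _ _ ht, h t ht]

theorem coeff_rename_of_forall (ι : σ ↪ τ) (f : MvPowerSeries σ R) {e : τ →₀ ℕ}
    (h : ∀ t ∉ Set.range ι, e t = 0) : coeff e (rename ι f) = coeff (pullExp ι e) f := by
  conv_lhs => rw [← embDomain_pullExp ι h]
  rw [coeff_embDomain_rename]

theorem coeff_rename_of_exists (ι : σ ↪ τ) (f : MvPowerSeries σ R) {e : τ →₀ ℕ}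
    (h : ∃ t ∉ Set.range ι, e t ≠ 0) : coeff e (rename ι f) = 0 := by
  apply coeff_rename_eq_zero
  rintro ⟨x, rfl⟩
  obtain ⟨t, ht, ht'⟩ := h
  exact ht' (Finsupp.mapDomain_of_notMem_range _ _ ht)

open Classical in
/-- The coefficients of a product of power series in disjoint sets of variables. -/
theorem coeff_rename_mul_rename (ι : σ ↪ ρ) (κ : τ ↪ ρ)
    (hικ : ∀ s t, ι s ≠ κ t) (f : MvPowerSeries σ R) (g : MvPowerSeries τ R) (e : ρ →₀ ℕ) :
    coeff e (rename ι f * rename κ g) =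
      if ∀ t, t ∉ Set.range ι → t ∉ Set.range κ → e t = 0 then
        coeff (pullExp ι e) f * coeff (pullExp κ e) g else 0 := by
  rw [coeff_mul]
  split_ifs with h
  · rw [Finset.sum_eq_single (Finsupp.embDomain ι (pullExp ι e),
      Finsupp.embDomain κ (pullExp κ e))]
    · rw [coeff_embDomain_rename, coeff_embDomain_rename]
    · rintro ⟨a, b⟩ hab hne
      rw [Finset.HasAntidiagonal.mem_antidiagonal] at hab
      by_cases ha : ∃ t ∉ Set.range ι, a t ≠ 0
      · rw [coeff_rename_of_exists ι f ha, zero_mul]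
      by_cases hb : ∃ t ∉ Set.range κ, b t ≠ 0
      · rw [coeff_rename_of_exists κ g hb, mul_zero]
      push Not at ha hb
      refine absurd ?_ hne
      have e1 : pullExp ι e = pullExp ι a := by
        ext s
        have : b (ι s) = 0 := hb _ (by rintro ⟨t, ht⟩; exact hικ s t ht.symm)
        simp [← hab, this]
      have e2 : pullExp κ e = pullExp κ b := by
        ext s
        have : a (κ s) = 0 := ha _ (by rintro ⟨t, ht⟩; exact hικ t s ht)
        simp [← hab, this]
      rw [e1, e2, embDomain_pullExp ι ha, embDomain_pullExp κ hb]
    · intro hn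
      refine absurd ?_ hn
      rw [Finset.HasAntidiagonal.mem_antidiagonal]
      ext t
      rw [Finsupp.add_apply]
      by_cases ht : t ∈ Set.range ι
      · obtain ⟨s, rfl⟩ := ht
        rw [Finsupp.embDomain_apply_self, Finsupp.embDomain_of_notMem_range, add_zero, pullExp_apply]
        rintro ⟨t, ht⟩
        exact hικ s t ht.symm
      · by_cases ht' : t ∈ Set.range κ
        · obtain ⟨s, rfl⟩ := ht'
          rw [Finsupp.embDomain_apply_self, Finsupp.embDomain_of_notMem_range _ _ _ ht, zero_add,
            pullExp_apply]
        · rw [Finsupp.embDomain_of_notMem_range _ _ _ ht, Finsupp.embDomain_of_notMem_range _ _ _ ht',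
            h t ht ht', add_zero]
  · push Not at h
    obtain ⟨t, ht, ht', het⟩ := h
    refine Finset.sum_eq_zero fun p hp => ?_
    rw [Finset.HasAntidiagonal.mem_antidiagonal] at hp
    by_cases ha : p.1 t = 0
    · rw [coeff_rename_of_exists κ g ⟨t, ht', ?_⟩, mul_zero]
      intro hb
      rw [← hp, Finsupp.add_apply, ha, hb] at het
      exact het rfl
    · rw [coeff_rename_of_exists ι f ⟨t, ht, ha⟩, zero_mul]

/-- Substituting the variables in the range of an injection by variables and the others by zero. -/
theorem coeff_subst_of_range [Finite τ] (ι : σ ↪ τ) {a : τ → MvPowerSeries σ R} (ha : ∀ s, a (ι s) = X s)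
    (ha' : ∀ t ∉ Set.range ι, a t = 0) (f : MvPowerSeries τ R) (e : σ →₀ ℕ) :
    coeff e (subst a f) = coeff (Finsupp.embDomain ι e) f := by
  classical
  have hs : HasSubst a := by
    apply hasSubst_of_constantCoeff_zero
    intro t
    by_cases ht : t ∈ Set.range ι
    · obtain ⟨s, rfl⟩ := ht
      rw [ha, constantCoeff_X]
    · rw [ha' t ht, map_zero]
  have hprod : ∀ d : σ →₀ ℕ, ((Finsupp.embDomain ι d).prod fun t n => a t ^ n) = monomial d 1 := by
    intro d
    rw [Finsupp.prod_embDomain, monomial_one_eq]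
    simp only [ha]
  rw [coeff_subst hs, finsum_eq_single _ (Finsupp.embDomain ι e)]
  · rw [hprod, coeff_monomial_same, smul_eq_mul, mul_one]
  · intro d hd
    by_cases h : ∀ t ∉ Set.range ι, d t = 0
    · rw [← embDomain_pullExp ι h, hprod, coeff_monomial_ne, smul_zero]
      rintro rfl
      exact hd (embDomain_pullExp ι h).symm
    · push Not at h
      obtain ⟨t, ht, hdt⟩ := h
      rw [Finsupp.prod, Finset.prod_eq_zero (Finsupp.mem_support_iff.2 hdt), map_zero, smul_zero]
      rw [ha' t ht, zero_pow hdt]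

theorem rename_subst [Finite τ] {a : σ → MvPowerSeries τ R} (ha : HasSubst a) (κ : τ → ρ)
    (f : MvPowerSeries σ R) :
    rename κ (subst a f) = subst (fun s => rename κ (a s)) f := by
  simp only [rename_eq_subst]
  exact subst_comp_subst_apply ha (HasSubst.X_comp κ) f

theorem subst_rename [Finite σ] {a : τ → MvPowerSeries ρ R} (ha : HasSubst a) (κ : σ → τ)
    (f : MvPowerSeries σ R) :
    subst a (rename κ f) = subst (fun s => a (κ s)) f := by
  rw [rename_eq_subst, subst_comp_subst_apply (HasSubst.X_comp κ) ha]
  congr 1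
  ext1 s
  exact subst_X ha _

end powerSeries

/-! ### The generating series of a functional on `𝔥¹` -/

section zetaSeries

open MvPowerSeries

variable {R : Type} [CommRing R] [Algebra ℚ R]

/-- The generating series `∑ φ(z_{k₁} ⋯ z_{k_r}) X₁^(k₁ - 1) ⋯ X_r^(k_r - 1)`. -/
def zSeries (φ : H1 →ₗ[ℚ] R) (r : ℕ) : MvPowerSeries (Fin r) R :=
  fun e => φ (word (List.ofFn fun i => (e i).succPNat))

theorem coeff_zSeries (φ : H1 →ₗ[ℚ] R) (r : ℕ) (e : Fin r →₀ ℕ) :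
    coeff e (zSeries φ r) = φ (word (List.ofFn fun i => (e i).succPNat)) := rfl

/-- The generating series of the values of `φ` on the images of `d₁ ⋯ d_r` under `toH1`, with
respect to the monomials `∏ Y_i^(d_i) / d_i!`. -/
def dSeries (φ : H1 →ₗ[ℚ] R) (r : ℕ) : MvPowerSeries (Fin r) R :=
  fun e => (∏ i, ((e i).factorial : ℚ))⁻¹ • φ (toH1 (word (List.ofFn e)))

theorem coeff_dSeries (φ : H1 →ₗ[ℚ] R) (r : ℕ) (e : Fin r →₀ ℕ) :
    coeff e (dSeries φ r) =
      (∏ i, ((e i).factorial : ℚ))⁻¹ • φ (toH1 (word (List.ofFn e))) := rfl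

/-- The partial sums `Y₁ + ⋯ + Y_{r-j}`, for `j = 0, …, r - 1`. -/
def sumVar (R : Type) [CommRing R] (r : ℕ) (j : Fin r) : MvPowerSeries (Fin r) R :=
  ∑ i ∈ Finset.univ.filter (fun i : Fin r => (i : ℕ) + (j : ℕ) < r), X i

theorem hasSubst_sumVar {S : Type} [CommRing S] (r : ℕ) : HasSubst (sumVar S r) := by
  apply hasSubst_of_constantCoeff_zero
  intro j
  simp [sumVar]

/-- Split by whether the first letter is larger than 1, in which case it is a raised letter, or
equal to 1. -/
theorem zSeries_succ (φ : H1 →ₗ[ℚ] R) (r : ℕ) :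
    zSeries φ (r + 1) = X 0 * zSeries (φ ∘ₗ raise) (r + 1)
      + rename (Fin.succEmb r) (zSeries (φ ∘ₗ cons 1) r) := by
  ext e
  rw [map_add, coeff_X_mul, coeff_zSeries, List.ofFn_succ]
  by_cases h : e 0 = 0
  · rw [if_pos h, zero_add, coeff_rename_of_forall, coeff_zSeries, LinearMap.comp_apply,
      cons_word, h]
    · rfl
    · intro t ht
      cases t using Fin.cases with
      | zero => exact h
      | succ i => exact absurd ⟨i, rfl⟩ ht
  · rw [if_neg h, coeff_rename_of_exists, add_zero, coeff_zSeries, List.ofFn_succ,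
      LinearMap.comp_apply, raise, lift_word, raiseHead]
    · congr 3
      · apply PNat.eq
        simp only [Finsupp.tsub_apply, Finsupp.single_eq_same, PNat.add_coe, Nat.succPNat_coe,
          PNat.one_coe]
        omega
      · congr 1
        ext1 i
        simp
    · exact ⟨0, by rintro ⟨i, hi⟩; exact Fin.succ_ne_zero i hi, h⟩

theorem lower_ofFn {r : ℕ} (e : Fin r → ℕ) :
    lower (word (List.ofFn e)) =
      ∑ i, (e i : ℚ) • word (List.ofFn (Function.update e i (e i - 1))) := by
  induction r with
  | zero => simp
  | succ r ih =>
    rw [List.ofFn_succ, ← cons_word, lower_cons, ih, Fin.sum_univ_succ, map_sum]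
    congr 1
    · rw [List.ofFn_succ, cons_word]
      simp
    · refine Finset.sum_congr rfl fun i _ => ?_
      rw [map_smul, cons_word, List.ofFn_succ]
      congr 4
      ext1 j
      by_cases h : j = i
      · subst h; simp
      · simp [Function.update_of_ne h, Function.update_of_ne ((Fin.succ_injective r).ne h)]

theorem dropZero_ofFn {r : ℕ} (e : Fin (r + 1) → ℕ) :
    dropZero (word (List.ofFn e)) =
      if e (Fin.last r) = 0 then word (List.ofFn fun i => e (Fin.castSucc i)) else 0 := by
  rw [List.ofFn_succ', List.concat_eq_append, ← snoc_word, dropZero_snoc]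

/-- This is `toH1_eq` in generating series. With the factorial normalization, multiplication by the
sum of all variables is `lower`, and independence of the last variable is `dropZero`. -/
theorem dSeries_succ (φ : H1 →ₗ[ℚ] R) (r : ℕ) :
    dSeries φ (r + 1) = (∑ i, X i) * dSeries (φ ∘ₗ raise) (r + 1)
      + rename Fin.castSuccEmb (dSeries (φ ∘ₗ cons 1) r) := by
  ext e
  have hX : coeff e ((∑ i, X i) * dSeries (φ ∘ₗ raise) (r + 1)) =
      (∏ i, ((e i).factorial : ℚ))⁻¹ • φ (raise (toH1 (lower (word (List.ofFn e))))) := by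
    rw [Finset.sum_mul, map_sum, lower_ofFn, map_sum, map_sum, map_sum, Finset.smul_sum]
    refine Finset.sum_congr rfl fun i _ => ?_
    rw [coeff_X_mul, map_smul, map_smul, map_smul, smul_smul]
    by_cases h : e i = 0
    · rw [if_pos h, h, Nat.cast_zero, mul_zero, zero_smul]
    · have hu : ((e - Finsupp.single i 1 : Fin (r + 1) →₀ ℕ) : Fin (r + 1) → ℕ) =
           Function.update e i (e i - 1) := by
        ext j
        by_cases hj : j = i
        · subst hj; simp
        · simp [Function.update_of_ne hj, Ne.symm hj]
      rw [if_neg h, coeff_dSeries, hu, LinearMap.comp_apply]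
      congr 1
      have h1 : ∏ j, ((e j).factorial : ℚ) =
          e i * ∏ j, ((Function.update e i (e i - 1) j).factorial : ℚ) := by
        rw [← Finset.mul_prod_erase _ _ (Finset.mem_univ i),
          ← Finset.mul_prod_erase _ (fun j => ((Function.update e i (e i - 1) j).factorial : ℚ))
            (Finset.mem_univ i), ← mul_assoc]
        congr 1
        · rw [Function.update_self, ← Nat.cast_mul, Nat.mul_factorial_pred h]
        · refine Finset.prod_congr rfl fun j hj => ?_
          rw [Function.update_of_ne (Finset.ne_of_mem_erase hj)]
      have h2 : (e i : ℚ) ≠ 0 := Nat.cast_ne_zero.2 h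
      rw [h1, mul_inv_rev, mul_assoc, inv_mul_cancel₀ h2, mul_one]
  have hY : coeff e (rename Fin.castSuccEmb (dSeries (φ ∘ₗ cons 1) r)) =
      (∏ i, ((e i).factorial : ℚ))⁻¹ • φ (cons 1 (toH1 (dropZero (word (List.ofFn e))))) := by
    rw [dropZero_ofFn]
    by_cases h : e (Fin.last r) = 0
    · rw [if_pos h, coeff_rename_of_forall, coeff_dSeries, Fin.prod_univ_castSucc, h]
      · simp
        rfl
      · intro t ht
        cases t using Fin.lastCases with
        | last => exact h
        | cast i => exact absurd ⟨i, rfl⟩ ht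
    · rw [if_neg h, coeff_rename_of_exists]
      · simp
      · exact ⟨Fin.last r, by rintro ⟨i, hi⟩; exact (Fin.castSucc_ne_last i) hi, h⟩
  rw [map_add, hX, hY, ← smul_add, ← map_add, coeff_dSeries, toH1_eq, List.ofFn_succ, ← cons_word,
    eps_cons, zero_smul, zero_add]

/-- After the substitution the first variable becomes the sum of all variables, so both sides
satisfy the recursion of `dSeries_succ`. That recursion determines the coefficients degree by
degree, its unknown term being multiplied by a linear form. -/
theorem subst_sumVar_zSeries (φ : H1 →ₗ[ℚ] R) (r : ℕ) :
    subst (sumVar R r) (zSeries φ r) = dSeries φ r := by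
  induction r generalizing φ with
  | zero =>
    ext e
    rw [Subsingleton.elim (sumVar R 0) X, subst_self, id_eq, coeff_zSeries, coeff_dSeries]
    simp
  | succ r ih =>
    have hrec : ∀ φ : H1 →ₗ[ℚ] R, subst (sumVar R (r + 1)) (zSeries φ (r + 1)) =
        (∑ i, X i) * subst (sumVar R (r + 1)) (zSeries (φ ∘ₗ raise) (r + 1)) +
          rename Fin.castSuccEmb (dSeries (φ ∘ₗ cons 1) r) := by
      intro φ
      rw [zSeries_succ φ r, subst_add (hasSubst_sumVar _), subst_mul (hasSubst_sumVar _),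
        subst_X (hasSubst_sumVar _), subst_rename (hasSubst_sumVar _), ← ih,
        rename_subst (hasSubst_sumVar _)]
      congr 2
      · simp only [sumVar, Fin.val_zero, add_zero, Fin.is_lt, Finset.filter_true]
      · ext1 j
        simp only [sumVar, map_sum, rename_X]
        rw [Finset.sum_filter, Finset.sum_filter, Fin.sum_univ_castSucc, if_neg, add_zero]
        · refine Finset.sum_congr rfl fun i _ => ?_
          have : (i.castSucc : ℕ) + (Fin.succEmb r j : ℕ) < r + 1 ↔ (i : ℕ) + j < r := by
            simp only [Fin.val_castSucc, Fin.coe_succEmb, Fin.val_succ]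
            omega
          simp only [this]
          rfl
        · simp only [Fin.val_last, Fin.coe_succEmb, Fin.val_succ]
          omega
    -- The functional stays general, because the recursion replaces it by `φ ∘ₗ raise`.
    suffices h : ∀ (n : ℕ) (e : Fin (r + 1) →₀ ℕ), e.degree = n → ∀ φ : H1 →ₗ[ℚ] R,
        coeff e (subst (sumVar R (r + 1)) (zSeries φ (r + 1))) = coeff e (dSeries φ (r + 1)) by
      ext e
      exact h _ e rfl φ
    intro n
    induction n with
    | zero =>
      intro e he φ
      rw [hrec, dSeries_succ, map_add, map_add]
      congr 1
      rw [Finsupp.degree_eq_zero_iff] at he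
      simp [he, Finset.sum_mul]
    | succ n ihn =>
      intro e he φ
      rw [hrec, dSeries_succ, map_add, map_add]
      congr 1
      rw [Finset.sum_mul, Finset.sum_mul, map_sum, map_sum]
      refine Finset.sum_congr rfl fun i _ => ?_
      rw [coeff_X_mul, coeff_X_mul]
      split_ifs with hi
      · rfl
      · refine ihn _ ?_ _
        have h1 : Finsupp.single i 1 ≤ e := by rw [Finsupp.single_le_iff]; omega
        have h2 := congrArg Finsupp.degree (tsub_add_cancel_of_le h1)
        rw [map_add, Finsupp.degree_single] at h2
        omega

end zetaSeries

section swapSeries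

open MvPowerSeries

variable {R : Type} [CommRing R] [Algebra ℚ R]

/-! ### Swap invariance in terms of generating series -/

/-- The generating series of the values of a homomorphism on the words of length `r`. -/
def gSeries (G : QA →ₐ[ℚ] R) (r : ℕ) : BiSeries r R := map (G : QA →+* R) (genSeries r)

theorem coeff_gSeries (G : QA →ₐ[ℚ] R) (r : ℕ) (e : Fin r ⊕ Fin r →₀ ℕ) :
    coeff e (gSeries G r) =
      (∏ i : Fin r, ((e (Sum.inr i)).factorial : ℚ))⁻¹ • G (word (wordOfExp e)) :=
  map_smul G _ _

theorem map_varX (G : QA →ₐ[ℚ] R) (r i : ℕ) :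
    map (G : QA →+* R) (varX QA r i) = varX R r i := by
  unfold varX
  split_ifs <;> simp

theorem map_swapVar (G : QA →ₐ[ℚ] R) (r : ℕ) (i : Fin r ⊕ Fin r) :
    map (G : QA →+* R) (swapVar QA r i) = swapVar R r i := by
  cases i with
  | inl j => simp [swapVar]
  | inr j => simp [swapVar, map_varX]

theorem map_swapCoeff (G : QA →ₐ[ℚ] R) {r : ℕ} (e : Fin r ⊕ Fin r →₀ ℕ) :
    G (swapCoeff e) = (∏ i : Fin r, ((e (Sum.inr i)).factorial : ℚ)) •
      coeff e (swapSeries (gSeries G r)) := by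
  have h := map_subst (hasSubst_swapVar QA r) (h := (G : QA →+* R)) (genSeries r)
  simp only [map_swapVar] at h
  rw [swapCoeff, map_smul, swapSeries, swapSeries, gSeries, ← h, coeff_map]
  rfl

theorem wordOfExp_expOfWord (w : List BiLetter) : wordOfExp (expOfWord w) = w := by
  conv_rhs => rw [← List.ofFn_get w]
  simp [wordOfExp, expOfWord]

theorem swapWord_wordOfExp {r : ℕ} (e : Fin r ⊕ Fin r →₀ ℕ) :
    swapWord (wordOfExp e) = swapCoeff e := by
  have key : ∀ w : List BiLetter, wordOfExp e = w → swapWord w = swapCoeff e := by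
    intro w hw
    have hr : r = w.length := by rw [← hw, wordOfExp, List.length_ofFn]
    subst hr
    rw [swapWord]
    congr 1
    have h : (fun i => ((e (Sum.inl i)).succPNat, e (Sum.inr i))) = w.get :=
      List.ofFn_injective (hw.trans (List.ofFn_get w).symm)
    ext i
    cases i with
    | inl i =>
      have := congrArg Prod.fst (congrFun h i)
      simp only [expOfWord, Finsupp.equivFunOnFinite_symm_apply_apply, Sum.elim_inl, ← this,
        Nat.natPred_succPNat]
    | inr i =>
      have := congrArg Prod.snd (congrFun h i)
      simp only [expOfWord, Finsupp.equivFunOnFinite_symm_apply_apply, Sum.elim_inr, ← this]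
  exact key _ rfl

theorem prod_factorial_ne_zero {r : ℕ} (e : Fin r → ℕ) : ∏ i, ((e i).factorial : ℚ) ≠ 0 :=
  Finset.prod_ne_zero_iff.2 fun _ _ => Nat.cast_ne_zero.2 (Nat.factorial_ne_zero _)

theorem swapSeries_gSeries {G : QA →ₐ[ℚ] R} (hG : ∀ w, G (swapWord w) = G (word w)) (r : ℕ) :
    swapSeries (gSeries G r) = gSeries G r := by
  ext e
  have h := hG (wordOfExp e)
  rw [swapWord_wordOfExp, map_swapCoeff] at h
  rw [coeff_gSeries, ← h, smul_smul,
    inv_mul_cancel₀ (prod_factorial_ne_zero fun i => e (Sum.inr i)), one_smul]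

theorem map_swapWord_of_swapSeries {G : QA →ₐ[ℚ] R}
    (hG : ∀ r, swapSeries (gSeries G r) = gSeries G r) (w : List BiLetter) :
    G (swapWord w) = G (word w) := by
  rw [swapWord, map_swapCoeff, hG, coeff_gSeries, smul_smul,
    mul_inv_cancel₀ (prod_factorial_ne_zero fun i => expOfWord w (Sum.inr i)), one_smul,
    wordOfExp_expOfWord]

/-- Swap invariance determines the values at the words `[1, …, 1; d]` by those at the words
`[k; 0]`. -/
theorem map_ones_of_swap {G : QA →ₐ[ℚ] R} (hG : ∀ w, G (swapWord w) = G (word w)) (d : List ℕ) :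
    G (word (ones d)) = G (zerosIncl (toH1 (word d))) := by
  obtain ⟨r, e, rfl⟩ : ∃ (r : ℕ) (e : Fin r →₀ ℕ), d = List.ofFn e :=
    ⟨d.length, Finsupp.equivFunOnFinite.symm d.get, by
      rw [Finsupp.coe_equivFunOnFinite_symm, List.ofFn_get]⟩
  have hX : HasSubst (Sum.elim (fun _ => 0) X : Fin r ⊕ Fin r → MvPowerSeries (Fin r) R) := by
    apply hasSubst_of_constantCoeff_zero
    rintro (i | i) <;> simp
  have hY : HasSubst (Sum.elim X (fun _ => 0) : Fin r ⊕ Fin r → MvPowerSeries (Fin r) R) := by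
    apply hasSubst_of_constantCoeff_zero
    rintro (i | i) <;> simp
  -- Setting all Y to zero keeps only the words [k;0].
  have h1 : subst (Sum.elim X (fun _ => 0) : Fin r ⊕ Fin r → MvPowerSeries (Fin r) R)
      (gSeries G r) = zSeries (G.comp zerosIncl).toLinearMap r := by
    ext e
    rw [coeff_subst_of_range Function.Embedding.inl (fun s => rfl) (by
      rintro (i | i) hi
      · exact absurd ⟨i, rfl⟩ hi
      · rfl), coeff_gSeries, coeff_zSeries]
    simp [wordOfExp, List.map_ofFn, Function.comp_def]
  -- Setting all X to zero after the swap sends the original Y variables to zero and the original X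
  -- variables to partial sums, which is the series of `toH1`. Without the swap it would keep only
  -- the words [1,…,1;d].
  have h2 : subst (Sum.elim (fun _ => 0) X : Fin r ⊕ Fin r → MvPowerSeries (Fin r) R)
      (swapSeries (gSeries G r)) = dSeries (G.comp zerosIncl).toLinearMap r := by
    rw [← subst_sumVar_zSeries, ← h1, swapSeries, subst_comp_subst_apply (hasSubst_swapVar R r) hX,
      subst_comp_subst_apply hY (hasSubst_sumVar r)]
    congr 1
    ext1 i
    rw [← coe_substAlgHom hX, ← coe_substAlgHom (hasSubst_sumVar r)]
    cases i with
    | inl j => simp only [swapVar, map_sum, substAlgHom_X, Sum.elim_inl, Sum.elim_inr, sumVar]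
    | inr j =>
      simp only [swapVar, varX, Sum.elim_inr, map_zero, map_sub]
      split_ifs <;> simp only [substAlgHom_X, map_zero, Sum.elim_inl, sub_self]
  rw [swapSeries_gSeries hG] at h2
  have h3 := congrArg (coeff e) h2
  rw [coeff_subst_of_range Function.Embedding.inr (fun s => rfl) (by
      rintro (i | i) hi
      · rfl
      · exact absurd ⟨i, rfl⟩ hi), coeff_gSeries, coeff_dSeries] at h3
  have hr : ∀ i, Finsupp.embDomain Function.Embedding.inr e (Sum.inr i : Fin r ⊕ Fin r) = e i :=
    fun i => Finsupp.embDomain_apply_self Function.Embedding.inr e i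
  have hl : ∀ i, Finsupp.embDomain Function.Embedding.inr e (Sum.inl i : Fin r ⊕ Fin r) = 0 :=
    fun i => Finsupp.embDomain_of_notMem_range _ _ _ (by rintro ⟨j, hj⟩; cases hj)
  have hw : wordOfExp (Finsupp.embDomain Function.Embedding.inr e) = ones (List.ofFn e) := by
    simp only [wordOfExp, hl, hr, ones, List.map_ofFn]
    rfl
  simp only [hr, hw] at h3
  exact smul_right_injective R (inv_ne_zero (prod_factorial_ne_zero e)) h3

end swapSeries

/-! ### Initial and final segments of lists given by functions -/

theorem take_ofFn {α : Type} {r m : ℕ} (h : m ≤ r) (f : Fin r → α) :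
    (List.ofFn f).take m = List.ofFn fun j : Fin m => f (Fin.castLE h j) := by
  apply List.ext_getElem
  · simp [h]
  · intro i h1 h2
    simp

theorem drop_ofFn {α : Type} {r i : ℕ} (f : Fin r → α) :
    (List.ofFn f).drop i = List.ofFn fun j : Fin (r - i) => f ⟨i + j, by omega⟩ := by
  apply List.ext_getElem
  · simp
  · intro i h1 h2
    simp

theorem forall_mem_take_ofFn {α : Type} {p : α → Prop} {r i : ℕ} (f : Fin r → α) :
    (∀ a ∈ (List.ofFn f).take i, p a) ↔ ∀ j : Fin r, (j : ℕ) < i → p (f j) := by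
  simp only [List.mem_take_iff_getElem, List.getElem_ofFn, List.length_ofFn]
  constructor
  · exact fun h j hj => h _ ⟨j, by omega, rfl⟩
  · rintro h _ ⟨j, hj, rfl⟩
    exact h ⟨j, by omega⟩ (by simp; omega)

theorem forall_mem_drop_ofFn {α : Type} {p : α → Prop} {r i : ℕ} (f : Fin r → α) :
    (∀ a ∈ (List.ofFn f).drop i, p a) ↔ ∀ j : Fin r, i ≤ (j : ℕ) → p (f j) := by
  rw [drop_ofFn]
  simp only [List.forall_mem_ofFn_iff]
  constructor
  · intro h j hj
    have := h ⟨j - i, by omega⟩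
    simpa [Nat.add_sub_cancel' hj] using this
  · exact fun h j => h _ (by simp)

section swapInvariance

open MvPowerSeries

variable {R : Type} [CommRing R] [Algebra ℚ R]

/-! ### The two types of series exchanged by the swap -/

/-- The series `F(Y₁ + ⋯ + Y_m, …, Y₁ + Y₂, Y₁)`, where `F` is the generating series of `φ` on words
of length `m`. -/
def ySeries (φ : H1 →ₗ[ℚ] R) (r m : ℕ) : BiSeries r R :=
  subst (fun j : Fin m => ∑ i ∈ Finset.univ.filter (fun i : Fin r => (i : ℕ) + (j : ℕ) < m),
    (X (Sum.inr i) : BiSeries r R)) (zSeries φ m)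

/-- The series `F(X_{r-l+1}, …, X_r)`, where `F` is the generating series of `φ` on words of
length `l`. -/
def xSeries (φ : H1 →ₗ[ℚ] R) (r l : ℕ) : BiSeries r R :=
  subst (fun j : Fin l => varX R r (r - l + j)) (zSeries φ l)

theorem hasSubst_ySeries {S : Type} [CommRing S] (r m : ℕ) : HasSubst (fun j : Fin m =>
    ∑ i ∈ Finset.univ.filter (fun i : Fin r => (i : ℕ) + (j : ℕ) < m),
      (X (Sum.inr i) : BiSeries r S)) := by
  apply hasSubst_of_constantCoeff_zero
  intro j
  simp

theorem hasSubst_xSeries {S : Type} [CommRing S] (r l : ℕ) :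
    HasSubst (fun j : Fin l => (varX S r (r - l + j) : BiSeries r S)) := by
  apply hasSubst_of_constantCoeff_zero
  intro j
  unfold varX
  split_ifs <;> simp

/-- The variables `Y₁, …, Y_m`. -/
def yEmb {r m : ℕ} (h : m ≤ r) : Fin m ↪ Fin r ⊕ Fin r :=
  (Fin.castLEEmb h).trans Function.Embedding.inr

/-- The variables `X_{r-l+1}, …, X_r`. -/
def xEmb {r l : ℕ} (h : l ≤ r) : Fin l ↪ Fin r ⊕ Fin r :=
  ⟨fun j => Sum.inl ⟨r - l + j, by omega⟩, fun i j hij => by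
    simp only [Sum.inl.injEq, Fin.mk.injEq] at hij
    exact Fin.ext (by omega)⟩

theorem ySeries_eq_rename (φ : H1 →ₗ[ℚ] R) {r m : ℕ} (h : m ≤ r) :
    ySeries φ r m = rename (yEmb h) (dSeries φ m) := by
  rw [← subst_sumVar_zSeries, rename_subst (hasSubst_sumVar m), ySeries]
  congr 1
  ext1 j
  simp only [sumVar, map_sum, rename_X]
  refine (Finset.sum_of_injOn (Fin.castLE h) (Fin.castLE_injective h).injOn ?_ ?_ ?_).symm
  · intro i hi
    simpa using hi
  · intro i hi hi'
    refine absurd ?_ hi'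
    simp only [Finset.mem_filter, Finset.mem_univ, true_and] at hi
    exact ⟨⟨i, by omega⟩, by simpa using hi, rfl⟩
  · intro i _
    rfl

theorem xSeries_eq_rename (φ : H1 →ₗ[ℚ] R) {r l : ℕ} (h : l ≤ r) :
    xSeries φ r l = rename (xEmb h) (zSeries φ l) := by
  rw [rename_eq_subst, xSeries]
  congr 1
  ext1 j
  rw [varX, dif_pos (by omega)]
  rfl

theorem varX_self {S : Type} [CommRing S] (r : ℕ) : varX S r r = 0 := by
  rw [varX, dif_neg (lt_irrefl r)]

/-- Counted from the last one, the X variables go to partial sums of the Y variables whose lengths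
do not depend on `r`. -/
theorem swapSeries_xSeries (φ : H1 →ₗ[ℚ] R) {r l : ℕ} (h : l ≤ r) :
    swapSeries (xSeries φ r l) = ySeries φ r l := by
  rw [swapSeries, xSeries, subst_comp_subst_apply (hasSubst_xSeries r l) (hasSubst_swapVar R r),
    ySeries]
  congr 1
  ext1 j
  rw [varX, dif_pos (by omega), subst_X (hasSubst_swapVar R r), swapVar]
  refine Finset.sum_congr ?_ fun _ _ => rfl
  ext i
  simp only [Finset.mem_filter, Finset.mem_univ, true_and]
  omega

/-- The partial sums of the differences X_{r-i} - X_{r-i+1} telescope; the convention X_{r+1} = 0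
leaves a single variable. -/
theorem swapSeries_ySeries (φ : H1 →ₗ[ℚ] R) {r m : ℕ} (h : m ≤ r) :
    swapSeries (ySeries φ r m) = xSeries φ r m := by
  rw [swapSeries, ySeries, subst_comp_subst_apply (hasSubst_ySeries r m) (hasSubst_swapVar R r),
    xSeries]
  congr 1
  ext1 j
  rw [← coe_substAlgHom (hasSubst_swapVar R r), map_sum]
  simp only [substAlgHom_X, swapVar]
  have h1 : ∀ n ≤ r, ∑ i ∈ Finset.univ.filter (fun i : Fin r => (i : ℕ) < n),
      (varX R r (r - 1 - i) - varX R r (r - i)) = varX R r (r - n) := by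
    intro n hn
    have h2 : ∑ i ∈ Finset.univ.filter (fun i : Fin r => (i : ℕ) < n),
        (varX R r (r - 1 - i) - varX R r (r - i)) =
        ∑ i ∈ Finset.range n, (varX R r (r - (i + 1)) - varX R r (r - i)) := by
      refine Finset.sum_bij (fun i _ => (i : ℕ)) ?_ ?_ ?_ ?_
      · intro i hi
        simpa using hi
      · intro i _ j _ hij
        exact Fin.ext hij
      · intro i hi
        have := Finset.mem_range.1 hi
        exact ⟨⟨i, by omega⟩, by simpa using this, rfl⟩
      · intro i _
        rw [Nat.sub_sub, Nat.add_comm 1]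
    rw [h2, Finset.sum_range_sub (fun i => varX R r (r - i)), Nat.sub_zero, varX_self, sub_zero]
  rw [show r - m + (j : ℕ) = r - (m - j) by omega, ← h1 (m - j) (by omega)]
  refine Finset.sum_congr ?_ fun _ _ => rfl
  ext i
  simp only [Finset.mem_filter, Finset.mem_univ, true_and]
  omega

/-- The sum over `m + j + l = r` of `h_j` times the product of the series in `Y₁, …, Y_m` and
`X_{r-l+1}, …, X_r`. -/
def mixedSeries (φ : H1 →ₗ[ℚ] R) (h : ℕ → R) (r : ℕ) : BiSeries r R :=
  ∑ i ∈ Finset.range (r + 1), ∑ m ∈ Finset.range (i + 1),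
    C (h (i - m)) * (ySeries φ r m * xSeries φ r (r - i))

theorem swapSeries_mixedSeries (φ : H1 →ₗ[ℚ] R) (h : ℕ → R) (r : ℕ) :
    swapSeries (mixedSeries φ h r) = mixedSeries φ h r := by
  have h1 : swapSeries (mixedSeries φ h r) =
      ∑ i ∈ Finset.range (r + 1), ∑ m ∈ Finset.range (i + 1),
        C (h (i - m)) * (ySeries φ r (r - i) * xSeries φ r m) := by
    rw [swapSeries, mixedSeries, ← coe_substAlgHom (hasSubst_swapVar R r), map_sum]
    refine Finset.sum_congr rfl fun i hi => ?_
    rw [map_sum]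
    refine Finset.sum_congr rfl fun m hm => ?_
    have hi' := Finset.mem_range.1 hi
    have hm' := Finset.mem_range.1 hm
    rw [map_mul, map_mul, coe_substAlgHom, subst_C]
    rw [← swapSeries, ← swapSeries, swapSeries_ySeries φ (by omega), swapSeries_xSeries φ (by omega),
      mul_comm (xSeries φ r m)]
  rw [h1, mixedSeries, Finset.sum_sigma', Finset.sum_sigma']
  -- Exchanging the numbers `m` of Y variables and `r - i` of X variables is an involution that
  -- fixes `i - m`, hence the coefficient `h (i - m)`.
  refine Finset.sum_nbij' (fun p => ⟨r - p.2, r - p.1⟩) (fun p => ⟨r - p.2, r - p.1⟩) ?_ ?_ ?_ ?_ ?_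
  · rintro ⟨i, m⟩ hp
    simp only [Finset.mem_sigma, Finset.mem_range] at hp ⊢
    omega
  · rintro ⟨i, m⟩ hp
    simp only [Finset.mem_sigma, Finset.mem_range] at hp ⊢
    omega
  · rintro ⟨i, m⟩ hp
    simp only [Finset.mem_sigma, Finset.mem_range] at hp
    simp only [Sigma.mk.injEq, heq_eq_eq]
    omega
  · rintro ⟨i, m⟩ hp
    simp only [Finset.mem_sigma, Finset.mem_range] at hp
    simp only [Sigma.mk.injEq, heq_eq_eq]
    omega
  · rintro ⟨i, m⟩ hp
    simp only [Finset.mem_sigma, Finset.mem_range] at hp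
    simp only
    rw [show r - m - (r - i) = i - m by omega, show r - (r - m) = m by omega]

end swapInvariance

section realization

open MvPowerSeries

variable {R : Type} [CommRing R] [Algebra ℚ R]

/-! ### Characters of `ℚ⟨A⟩` from a shuffle character and a stuffle character -/

/-- The character of `ℚ⟨A⟩` supported on the words `[1, …, 1; d]` given by a character of the
shuffle algebra. -/
def onesChar (φ : WordAlg ℕ →ₗ[ℚ] R) (h1 : φ (word []) = 1)
    (hφ : ∀ f g, φ (shuffle f g) = φ f * φ g) : QA →ₐ[ℚ] R :=
  algHomOfWord (φ ∘ₗ onesProj) (by simp [h1]) fun w v => by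
    simp only [LinearMap.comp_apply, onesProj_mul, hφ]

theorem onesChar_word (φ : WordAlg ℕ →ₗ[ℚ] R) (h1 : φ (word []) = 1)
    (hφ : ∀ f g, φ (shuffle f g) = φ f * φ g) (w : List BiLetter) :
    onesChar φ h1 hφ (word w) = if ∀ a ∈ w, a.1 = 1 then φ (word (w.map Prod.snd)) else 0 := by
  rw [onesChar, algHomOfWord_apply, LinearMap.comp_apply, onesProj_word]
  split_ifs <;> simp

theorem zerosChar_word (Z : H1 →ₐ[ℚ] R) (w : List BiLetter) :
    Z.comp zerosProj (word w) = if ∀ a ∈ w, a.2 = 0 then Z (word (w.map Prod.fst)) else 0 := by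
  rw [AlgHom.comp_apply, zerosProj_word]
  split_ifs <;> simp

theorem coeff_ySeries_mul_xSeries (φ : H1 →ₗ[ℚ] R) {r i m : ℕ} (hi : i ≤ r) (hm : m ≤ i)
    (e : Fin r ⊕ Fin r →₀ ℕ) :
    coeff e (ySeries φ r m * xSeries φ r (r - i)) =
      if (∀ j : Fin r, m ≤ (j : ℕ) → e (Sum.inr j) = 0) ∧
          ∀ j : Fin r, (j : ℕ) < i → e (Sum.inl j) = 0 then
        (∏ j : Fin r, ((e (Sum.inr j)).factorial : ℚ))⁻¹ •
          (φ (toH1 (word ((List.ofFn fun j => e (Sum.inr j)).take m))) *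
            φ (word ((List.ofFn fun j => (e (Sum.inl j)).succPNat).drop i)))
      else 0 := by
  classical
  rw [ySeries_eq_rename φ (hm.trans hi), xSeries_eq_rename φ (Nat.sub_le r i),
    coeff_rename_mul_rename _ _ (by intro s t h; cases h)]
  have hcond : (∀ t, t ∉ Set.range (yEmb (hm.trans hi)) → t ∉ Set.range (xEmb (Nat.sub_le r i)) →
      e t = 0) ↔ (∀ j : Fin r, m ≤ (j : ℕ) → e (Sum.inr j) = 0) ∧
        ∀ j : Fin r, (j : ℕ) < i → e (Sum.inl j) = 0 := by
    constructor
    · refine fun h => ⟨fun j hj => h _ ?_ ?_, fun j hj => h _ ?_ ?_⟩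
      · rintro ⟨s, hs⟩
        have := congrArg Fin.val (Sum.inr.inj hs)
        simp only [Fin.castLEEmb_apply, Fin.val_castLE] at this
        omega
      · rintro ⟨s, hs⟩; cases hs
      · rintro ⟨s, hs⟩; cases hs
      · rintro ⟨s, hs⟩
        have := congrArg Fin.val (Sum.inl.inj hs)
        simp only at this
        omega
    · rintro ⟨h1, h2⟩ (j | j) hy hx
      · refine h2 j (lt_of_not_ge fun hij => hx ⟨⟨j - i, by omega⟩, ?_⟩)
        refine congrArg Sum.inl (Fin.ext ?_)
        simp only
        omega
      · exact h1 j (le_of_not_gt fun hj => hy ⟨⟨j, hj⟩, rfl⟩)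
  by_cases hc : (∀ j : Fin r, m ≤ (j : ℕ) → e (Sum.inr j) = 0) ∧
      ∀ j : Fin r, (j : ℕ) < i → e (Sum.inl j) = 0
  · rw [if_pos (hcond.2 hc), if_pos hc, coeff_dSeries, coeff_zSeries, smul_mul_assoc,
      take_ofFn (hm.trans hi), drop_ofFn]
    -- The additional factors on the right are 0! = 1.
    have hprod : ∏ j : Fin m, ((pullExp (yEmb (hm.trans hi)) e j).factorial : ℚ) =
        ∏ j : Fin r, ((e (Sum.inr j)).factorial : ℚ) := by
      refine Finset.prod_of_injOn (Fin.castLE (hm.trans hi)) (Fin.castLE_injective _).injOn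
        (fun _ _ => Finset.mem_coe.2 (Finset.mem_univ _)) ?_ fun _ _ => rfl
      intro j _ hj
      rw [hc.1 j (le_of_not_gt fun hjm => hj ⟨⟨j, hjm⟩, by simp, rfl⟩), Nat.factorial_zero,
        Nat.cast_one]
    have hx : ∀ j, xEmb (Nat.sub_le r i) j = Sum.inl ⟨i + j, by omega⟩ := fun j =>
      congrArg Sum.inl (Fin.ext (by simp only; omega))
    rw [hprod]
    simp only [pullExp_apply, hx]
    rfl
  · rw [if_neg fun H => hc (hcond.1 H), if_neg hc]

/-- In `mixedSeries`, `i` is where deconcatenation cuts the word, and `m` is where `twist_word` cuts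
the first part into a word and `i - m` trailing zeros, weighted by `h (i - m)`. The support
conditions on the exponents say that the pieces have the required shapes. -/
theorem gSeries_conv (Z : H1 →ₐ[ℚ] R) (h : ℕ → R)
    (h1 : twist (Z.toLinearMap ∘ₗ toH1) h (word []) = 1)
    (hφ : ∀ f g, twist (Z.toLinearMap ∘ₗ toH1) h (shuffle f g) =
      twist (Z.toLinearMap ∘ₗ toH1) h f * twist (Z.toLinearMap ∘ₗ toH1) h g) (r : ℕ) :
    gSeries (conv (onesChar _ h1 hφ) (Z.comp zerosProj)) r = mixedSeries Z.toLinearMap h r := by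
  ext e
  have hlen : (wordOfExp e).length = r := by simp [wordOfExp]
  rw [coeff_gSeries, conv_word, hlen, mixedSeries, map_sum, Finset.smul_sum]
  refine Finset.sum_congr rfl fun i hi => ?_
  have hi' : i ≤ r := by have := Finset.mem_range.1 hi; omega
  rw [map_sum, onesChar_word, zerosChar_word, List.map_take, List.map_drop]
  have hfst : (wordOfExp e).map Prod.fst = List.ofFn fun j => (e (Sum.inl j)).succPNat := by
    simp [wordOfExp, List.map_ofFn, Function.comp_def]
  have hsnd : (wordOfExp e).map Prod.snd = List.ofFn fun j => e (Sum.inr j) := by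
    simp [wordOfExp, List.map_ofFn, Function.comp_def]
  have hones : (∀ a ∈ (wordOfExp e).take i, a.1 = 1) ↔
      ∀ j : Fin r, (j : ℕ) < i → e (Sum.inl j) = 0 := by
    rw [wordOfExp, forall_mem_take_ofFn]
    refine forall₂_congr fun j _ => ?_
    rw [← PNat.coe_inj]
    simp
  have hzeros : (∀ a ∈ (wordOfExp e).drop i, a.2 = 0) ↔
      ∀ j : Fin r, i ≤ (j : ℕ) → e (Sum.inr j) = 0 := by
    rw [wordOfExp, forall_mem_drop_ofFn]
  rw [hfst, hsnd]
  by_cases hA : ∀ a ∈ (wordOfExp e).take i, a.1 = 1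
  · by_cases hD : ∀ a ∈ (wordOfExp e).drop i, a.2 = 0
    · rw [if_pos hA, if_pos hD, twist_word, Finset.sum_mul, Finset.smul_sum]
      have hlen' : ((List.ofFn fun j => e (Sum.inr j)).take i).length = i := by simp [hi']
      rw [hlen']
      refine Finset.sum_congr rfl fun m hm => ?_
      have hm' : m ≤ i := by have := Finset.mem_range.1 hm; omega
      rw [coeff_C_mul, coeff_ySeries_mul_xSeries _ hi' hm', List.take_take, min_eq_left hm']
      have hE : (∀ a ∈ ((List.ofFn fun j => e (Sum.inr j)).take i).drop m, a = 0) ↔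
          ∀ j : Fin r, m ≤ (j : ℕ) → e (Sum.inr j) = 0 := by
        rw [take_ofFn hi', forall_mem_drop_ofFn]
        constructor
        · intro H j hj
          by_cases hji : (j : ℕ) < i
          · exact H ⟨j, hji⟩ hj
          · exact hzeros.1 hD j (by omega)
        · exact fun H j hj => H _ hj
      by_cases hm0 : ∀ j : Fin r, m ≤ (j : ℕ) → e (Sum.inr j) = 0
      · rw [if_pos (hE.2 hm0), if_pos ⟨hm0, hones.1 hA⟩, mul_smul_comm]
        congr 1
        simp only [LinearMap.comp_apply, AlgHom.toLinearMap_apply]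
        ring
      · rw [if_neg fun H => hm0 (hE.1 H), if_neg fun H => hm0 H.1]
        simp
    · rw [if_neg hD, mul_zero, smul_zero]
      refine (Finset.sum_eq_zero fun m hm => ?_).symm
      have hm' : m ≤ i := by have := Finset.mem_range.1 hm; omega
      rw [coeff_C_mul, coeff_ySeries_mul_xSeries _ hi' hm', if_neg, mul_zero]
      exact fun H => hD (hzeros.2 fun j hj => H.1 j (hm'.trans hj))
  · rw [if_neg hA, zero_mul, smul_zero]
    refine (Finset.sum_eq_zero fun m hm => ?_).symm
    have hm' : m ≤ i := by have := Finset.mem_range.1 hm; omega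
    rw [coeff_C_mul, coeff_ySeries_mul_xSeries _ hi' hm', if_neg, mul_zero]
    exact fun H => hA (hones.2 H.2)

/-- A homomorphism on `𝔥¹` satisfying the extended double shuffle relations extends to a swap
invariant homomorphism on `ℚ⟨A⟩` vanishing on all words without the special shape. -/
theorem exists_swap_invariant_extension (Z : H1 →ₐ[ℚ] R)
    (hZ : ∀ f g, g ∈ H0 → Z (shuffleH1 f g) = Z f * Z g) :
    ∃ B : QA →ₐ[ℚ] R, (∀ w, B (swapWord w) = B (word w)) ∧
      (∀ w, ¬ IsSpecial w → B (word w) = 0) ∧ ∀ f, B (zerosIncl f) = Z f := by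
  have hP : ∀ f g, dropZero g = 0 → (Z.toLinearMap ∘ₗ toH1) (shuffle f g) =
      (Z.toLinearMap ∘ₗ toH1) f * (Z.toLinearMap ∘ₗ toH1) g := by
    intro f g hg
    simp only [LinearMap.comp_apply, AlgHom.toLinearMap_apply, toH1_shuffle]
    exact hZ _ _ (toH1_mem_H0 hg)
  have hP1 : (Z.toLinearMap ∘ₗ toH1) (word []) = 1 := by
    rw [LinearMap.comp_apply, toH1_nil, ← one_eq_word]
    exact map_one Z
  -- Extended double shuffle gives multiplicativity only against H⁰, hence the passage to a twisted
  -- functional.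
  obtain ⟨h, h1, h0, hφ⟩ := exists_twist_shuffle _ hP1 hP
  refine ⟨conv (onesChar _ h1 hφ) (Z.comp zerosProj), ?_, ?_, ?_⟩
  · refine map_swapWord_of_swapSeries fun r => ?_
    rw [gSeries_conv, swapSeries_mixedSeries]
  · intro w hw
    rw [conv_word]
    refine Finset.sum_eq_zero fun i _ => ?_
    rw [onesChar_word, zerosChar_word]
    by_cases hu : ∀ a ∈ w.take i, a.1 = 1
    -- A cut where both factors are nonzero would exhibit the word as special.
    · rw [if_neg (fun hv => hw ⟨_, _, (List.take_append_drop i w).symm, hu, hv⟩), mul_zero]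
    · rw [if_neg hu, zero_mul]
  · intro f
    induction f using WordAlg.induction_on with
    | hw k =>
      -- Any cut with a nonempty first part evaluates the twisted character on a word of zeros,
      -- where it vanishes.
      rw [zerosIncl_word, conv_word, Finset.sum_eq_single 0]
      · rw [List.take_zero, ← one_eq_word, map_one, one_mul, List.drop_zero, zerosChar_word,
          if_pos (by simp)]
        simp [Function.comp_def]
      · intro i hi hi0
        have hlen := Finset.mem_range.1 hi
        rw [onesChar_word]
        split_ifs
        · rw [List.map_take, List.map_map]
          have : (k.map (Prod.snd ∘ fun i : ℕ+ => ((i, 0) : BiLetter))).take i =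
              List.replicate ((i - 1) + 1) 0 := by
            rw [Function.comp_def, List.map_const', List.take_replicate]
            congr 1
            simp at hlen
            omega
          rw [this, h0, zero_mul]
        · rw [zero_mul]
      · simp
    | hadd f g hf hg => simp only [map_add, hf, hg]
    | hsmul c f hf => simp only [map_smul, hf]

end realization

end

end FormalMES

/-! ### The homomorphism and its kernel -/

theorem theorem1p1 :
    ∃ π : FormalMES.FMES →ₐ[ℚ] FormalMES.FMZV,
      Function.Surjective π ∧
      (∀ k : List ℕ+, π (FormalMES.Gf₀ k) = FormalMES.zetaf k) ∧
      RingHom.ker π = FormalMES.idealN := by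
  open FormalMES FormalMES.WordAlg in
  let Z : H1 →ₐ[ℚ] FMZV := Ideal.Quotient.mkₐ ℚ edsIdeal
  have hZ : ∀ f g, g ∈ H0 → Z (shuffleH1 f g) = Z f * Z g := by
    intro f g hg
    rw [← map_mul]
    refine ((Ideal.Quotient.eq (I := edsIdeal)).2 ?_).symm
    exact Ideal.subset_span ⟨f, g, hg, rfl⟩
  obtain ⟨B, hswap, hspec, hB⟩ := exists_swap_invariant_extension Z hZ
  have hswap' : ∀ f, B (swap f) = B f := by
    intro f
    induction f using WordAlg.induction_on with
    | hw w => rw [swap, lift_word, hswap]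
    | hadd f g hf hg => simp only [map_add, hf, hg]
    | hsmul c f hf => simp only [map_smul, hf]
  have hker : ∀ a ∈ swapIdeal, B a = 0 := by
    intro a ha
    suffices swapIdeal ≤ RingHom.ker B from this ha
    refine Ideal.span_le.2 ?_
    rintro _ ⟨w, rfl⟩
    simp only [SetLike.mem_coe, RingHom.mem_ker, map_sub, hswap', sub_self]
  let π : FMES →ₐ[ℚ] FMZV := Ideal.Quotient.liftₐ swapIdeal B hker
  have hπ : ∀ f, π (Ideal.Quotient.mk swapIdeal f) = B f := fun f => rfl
  have hπN : idealN ≤ RingHom.ker π := by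
    refine Ideal.span_le.2 ?_
    rintro _ ⟨w, hw, rfl⟩
    exact hspec w hw
  -- Working modulo `idealN`, where non-special words vanish, reduces the kernel inclusion to
  -- injectivity of the map induced by π.
  let G : QA →ₐ[ℚ] FMES ⧸ idealN :=
    (Ideal.Quotient.mkₐ ℚ idealN).comp (Ideal.Quotient.mkₐ ℚ swapIdeal)
  have hG : ∀ w, ¬ IsSpecial w → G (word w) = 0 := fun w hw =>
    Ideal.Quotient.eq_zero_iff_mem.2 (Ideal.subset_span ⟨w, hw, rfl⟩)
  have hGswap : ∀ w, G (swapWord w) = G (word w) := by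
    intro w
    refine congrArg (Ideal.Quotient.mk idealN) ((Ideal.Quotient.eq (I := swapIdeal)).2 ?_)
    exact Ideal.subset_span ⟨word w, by rw [swap, lift_word]⟩
  have hP := map_ones_of_swap hGswap
  have heds : ∀ f ∈ edsIdeal, G (zerosIncl f) = 0 := by
    intro f hf
    suffices edsIdeal ≤ RingHom.ker (G.comp zerosIncl) from this hf
    refine Ideal.span_le.2 ?_
    rintro _ ⟨f, g, hg, rfl⟩
    exact map_zerosIncl_eds hG hP f hg
  refine ⟨π, fun z => ?_, fun k => ?_, le_antisymm (fun x hx => ?_) hπN⟩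
  · obtain ⟨f, rfl⟩ := Ideal.Quotient.mk_surjective z
    exact ⟨Ideal.Quotient.mk swapIdeal (zerosIncl f), (hπ _).trans (hB f)⟩
  · have h := hB (word k)
    rw [zerosIncl_word] at h
    exact h
  · obtain ⟨f, rfl⟩ := Ideal.Quotient.mk_surjective x
    obtain ⟨g, hg⟩ := map_mem_range_zerosIncl hG hP f
    -- Since π kills `idealN`, the class of `f` may be replaced by that of `zerosIncl g`, on which π
    -- is the class of `g`; its vanishing puts `g` in `edsIdeal`, which `G` kills.
    have hfg : Ideal.Quotient.mk swapIdeal f - Ideal.Quotient.mk swapIdeal (zerosIncl g) ∈ idealN :=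
      Ideal.Quotient.eq.1 hg.symm
    have h0 := hπN hfg
    rw [RingHom.mem_ker, map_sub, RingHom.mem_ker.1 hx, zero_sub, neg_eq_zero, hπ, hB] at h0
    have hg0 : G (zerosIncl g) = 0 := heds g (Ideal.Quotient.eq_zero_iff_mem.1 h0)
    exact Ideal.Quotient.eq_zero_iff_mem.1 (hg.symm.trans hg0)
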